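/- Let $\{Y_n, n\ge 1\}$ be a stationary sequence of jointly Gaussian random variables with mean $0$ and variance $1$, with covariance function $r_n=\mathrm{Cov}(Y_m,Y_{m+n})$ ($m\ge1$, $n\ge 0$), and suppose that $r_n\log n\to 0$ as $n\to\infty$. Let $d\ge 1$, let $\{Y_{nj}, n\ge 1\}$, $j=1,\dots,d$, be independent copies of $\{Y_n\}$, and put $$\chi_n=\Big(\sum_{j=1}^d Y_{nj}^2\Big)^{1/2},\qquad n\ge 1 .$$ Let $\{\widehat\chi_n, n\ge 1\}$ be an independent copy of $\{\chi_n, n\ge 1\}$. Let $\boldsymbol\varepsilon=\{\varepsilon_n, n\ge 1\}$ be a sequence of $\{0,1\}$-valued (Bernoulli) random variables, not assumed to be identically distributed or independent of each other, which is independent of the pair of sequences $(\{\chi_n\},\{\widehat\chi_n\})$, and suppose that $$\frac1n\sum_{k=1}^n\varepsilon_k\to\lambda\quad\text{in probability as } n\to\infty$$ for some random variable $\lambda$ with $\lambda\in[0,1]$ almost surely. Put $$\chi_n(\boldsymbol\varepsilon)=\varepsilon_n\chi_n+(1-\varepsilon_n)\widehat\chi_n,\qquad M_n(\chi)=\max_{1\le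 k\le n}\chi_k,\qquad M_n(\chi(\boldsymbol\varepsilon))=\max_{1\le k\le n}\chi_k(\boldsymbol\varepsilon).$$ Then for any $x,y\in\mathbb R$ $$\lim_{n\to\infty}P\big[M_n(\chi(\boldsymbol\varepsilon))\le a_n^{-1}x+b_n,\ M_n(\chi)\le a_n^{-1}y+b_n\big]=\exp\big(-e^{-\min\{x,y\}}\big)\,E\exp\big(-(1-\lambda)e^{-\max\{x,y\}}\big),$$ where $$a_n=(2\log n)^{1/2},\qquad b_n=a_n+a_n^{-1}\log\Big(2^{1-d/2}\,\Gamma(d/2)^{-1}\,a_n^{d-2}\Big).$$ -/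

import Mathlib

open MeasureTheory ProbabilityTheory Filter
open scoped Topology

/-- `Y` is a stationary sequence of standard normal random variables (jointly Gaussian) with
covariance function `r`. Time is indexed from zero: `Y k` is the `(k+1)`-st term. -/
structure IsStdGaussianSeq {Ω : Type*} [MeasurableSpace Ω]
    (Y : ℕ → Ω → ℝ) (r : ℕ → ℝ) (P : Measure Ω) : Prop where
  gaussian : IsGaussianProcess Y P
  standard : ∀ k, HasLaw (Y k) (gaussianReal 0 1) P
  covariance : ∀ k n, cov[Y k, Y (k + n); P] = r n

/-- The random sequence `X'` (on `Ω'`) is a copy of the random sequence `X` (on `Ω`): as random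
elements of `ℝ^ℕ` they have the same law. -/
def IsCopy {Ω Ω' : Type*} [MeasurableSpace Ω] [MeasurableSpace Ω']
    (X' : ℕ → Ω' → ℝ) (P' : Measure Ω') (X : ℕ → Ω → ℝ) (P : Measure Ω) : Prop :=
  IdentDistrib (fun ω k => X' k ω) (fun ω k => X k ω) P' P

/-- The chi sequence built from the `d` sequences `Z 0, …, Z (d-1)`. -/
noncomputable def chiSeq {Ω : Type*} {d : ℕ} (Z : Fin d → ℕ → Ω → ℝ) (k : ℕ) (ω : Ω) : ℝ :=
  Real.sqrt (∑ j, Z j k ω ^ 2)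

/-- The random replacing sequence `ε_k X_k + (1 - ε_k) X̂_k`. -/
def replacingSeq {Ω : Type*} (X X' ε : ℕ → Ω → ℝ) (k : ℕ) (ω : Ω) : ℝ :=
  ε k ω * X k ω + (1 - ε k ω) * X' k ω

/-- The maximum of the first `n` terms of a random sequence (only meant for `n ≥ 1`). -/
noncomputable def seqMax {Ω : Type*} (X : ℕ → Ω → ℝ) (n : ℕ) (ω : Ω) : ℝ :=
  ⨆ k : Fin n, X k ω

/-- The scaling constants `a_n = (2 log n)^{1/2}`. -/
noncomputable def chiA (n : ℕ) : ℝ :=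
  Real.sqrt (2 * Real.log n)

/-- The centring constants `b_n = a_n + a_n⁻¹ log (2^{1-d/2} Γ(d/2)⁻¹ a_n^{d-2})`. -/
noncomputable def chiB (d n : ℕ) : ℝ :=
  chiA n + (chiA n)⁻¹ *
    Real.log ((2 : ℝ) ^ (1 - (d : ℝ) / 2) * (Real.Gamma ((d : ℝ) / 2))⁻¹
      * chiA n ^ ((d : ℤ) - 2))

/-! Write `T` for the tail of the chi law and `u_n(x)` for the normalized level; polar coordinates
and l'Hôpital give `n T(u_n(x)) → exp(-x)`. Suppose first that the chi variables are independent.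
Condition on the set `S` of indices below `n` with `ε = 1`. An index in `S` contributes `1 - T` at
the lower level. An index outside `S` contributes a factor from `χ` and one from its copy, hence `1
- T` at both levels. The product depends on `S` only through `|S|`, and `|S|/n → λ` gives the limit
by dominated convergence (`tendsto_integral_exp_of_tendstoInMeasure`).

Dependence is removed by `eventually_abs_measureReal_forall_chiSeq_le_sub_prod_le`, uniformly in the
index set and in the choice between two levels at each index, as averaging over `S` requires. No
normal comparison inequality is used. If `X`, `V` are the Gaussian vectors at two times with
correlation `c`, then `V - c X` is independent of `X`, so `X` can be resampled inside `V`. The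
dependence error is at most the probability that a fresh `X` is large and that resampling changes
whether `V` exceeds its level (`abs_measureReal_inter_sub_le_sum`). For lags below `n^α` it suffices
that correlations are bounded away from 1 in absolute value. For longer lags, `r_m log m → 0` makes
the change of `V` smaller than `δ / a_n`, so `V` must lie in a thin shell around its level; the
total is controlled by letting `n → ∞` and then taking `δ` small. -/

/-! ### Tail asymptotics of the chi distribution. -/

/-- The tail `P(‖X‖ > u)` of the norm of a standard Gaussian vector in dimension `d`. -/
noncomputable def chiTail (d : ℕ) (u : ℝ) : ℝ :=
  (stdGaussian (EuclideanSpace ℝ (Fin d))).real {v | u < ‖v‖}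

lemma chiTail_nonneg (d : ℕ) (u : ℝ) : 0 ≤ chiTail d u := measureReal_nonneg

lemma chiTail_le_one (d : ℕ) (u : ℝ) : chiTail d u ≤ 1 := measureReal_le_one

lemma chiTail_antitone (d : ℕ) : Antitone (chiTail d) := fun _ _ h =>
  measureReal_mono fun _ hv => lt_of_le_of_lt h hv

lemma pi_gaussianReal_eq_withDensity {ι : Type*} [Fintype ι] :
    Measure.pi (fun _ : ι => gaussianReal 0 1) =
      volume.withDensity (fun x => ENNReal.ofReal (∏ i, gaussianPDFReal 0 1 (x i))) := by
  refine Measure.pi_eq fun s hs => ?_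
  have hint : Integrable (fun x : ι → ℝ => ∏ i, gaussianPDFReal 0 1 (x i))
      (Measure.pi fun i => (volume : Measure ℝ).restrict (s i)) :=
    Integrable.fintype_prod fun i => (integrable_gaussianPDFReal 0 1).restrict
  rw [withDensity_apply _ (MeasurableSet.univ_pi hs), volume_pi, Measure.restrict_pi_pi,
    ← ofReal_integral_eq_lintegral_ofReal hint
      (ae_of_all _ fun x => Finset.prod_nonneg fun i _ => gaussianPDFReal_nonneg _ _ _),
    integral_fintype_prod_eq_prod (f := fun i x => gaussianPDFReal 0 1 x),
    ENNReal.ofReal_prod_of_nonneg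
      fun i _ => integral_nonneg fun x => gaussianPDFReal_nonneg _ _ _]
  refine Finset.prod_congr rfl fun i _ => ?_
  rw [gaussianReal_apply_eq_integral _ one_ne_zero]

lemma prod_gaussianPDFReal {ι : Type*} [Fintype ι] (x : ι → ℝ) :
    ∏ i, gaussianPDFReal 0 1 (x i) =
      (√(2 * Real.pi))⁻¹ ^ Fintype.card ι * Real.exp (-(∑ i, x i ^ 2) / 2) := by
  simp only [gaussianPDFReal, Finset.prod_mul_distrib, Finset.prod_const, ← Real.exp_sum]
  simp [Finset.card_univ, ← Finset.sum_div, neg_div]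

lemma chiTail_eq_integral_pi (d : ℕ) (u : ℝ) :
    chiTail d u = ∫ v : EuclideanSpace ℝ (Fin d),
      (Set.Ioi u).indicator (fun r => (√(2 * Real.pi))⁻¹ ^ d * Real.exp (-r ^ 2 / 2)) ‖v‖ := by
  have hm : MeasurableSet {v : EuclideanSpace ℝ (Fin d) | u < ‖v‖} :=
    measurableSet_lt measurable_const measurable_norm
  have hm' : MeasurableSet (WithLp.toLp 2 ⁻¹' {v : EuclideanSpace ℝ (Fin d) | u < ‖v‖}) :=
    (MeasurableEquiv.toLp 2 _).measurable hm
  have hint : Integrable (fun x : Fin d → ℝ => ∏ i, gaussianPDFReal 0 1 (x i)) :=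
    Integrable.fintype_prod fun i => (integrable_gaussianPDFReal 0 1)
  rw [chiTail, ← map_pi_eq_stdGaussian, map_measureReal_apply
    (WithLp.measurable_toLp 2 _) hm, pi_gaussianReal_eq_withDensity, measureReal_def,
    withDensity_apply _ hm', ← ofReal_integral_eq_lintegral_ofReal hint.restrict
      (ae_of_all _ fun x => Finset.prod_nonneg fun i _ => gaussianPDFReal_nonneg _ _ _),
    ENNReal.toReal_ofReal
      (integral_nonneg fun x => Finset.prod_nonneg fun i _ => gaussianPDFReal_nonneg _ _ _),
    ← integral_indicator hm', ← (PiLp.volume_preserving_toLp (Fin d)).integral_comp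
      (MeasurableEquiv.toLp 2 _).measurableEmbedding]
  congr 1 with x
  simp only [Set.indicator, Set.mem_preimage, Set.mem_ofPred_eq, Set.mem_Ioi]
  split_ifs
  · rw [prod_gaussianPDFReal, EuclideanSpace.norm_sq_eq]; simp
  · rfl

/-- The normalizing constant `2^{1-d/2} / Γ(d/2)` of the chi density. -/
noncomputable def chiConst (d : ℕ) : ℝ :=
  (2 : ℝ) ^ (1 - (d : ℝ) / 2) * (Real.Gamma ((d : ℝ) / 2))⁻¹

lemma chiConst_pos {d : ℕ} (hd : 1 ≤ d) : 0 < chiConst d := by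
  have : 0 < Real.Gamma ((d : ℝ) / 2) := Real.Gamma_pos_of_pos (by positivity)
  unfold chiConst; positivity

lemma chiTail_eq_integral {d : ℕ} (hd : 1 ≤ d) {u : ℝ} (hu : 0 ≤ u) :
    chiTail d u = chiConst d * ∫ r in Set.Ioi u, r ^ (d - 1) * Real.exp (-r ^ 2 / 2) := by
  have : Nonempty (Fin d) := ⟨⟨0, hd⟩⟩
  have hd0 : (0 : ℝ) < d := by exact_mod_cast hd
  -- The integrand is radial, so polar coordinates apply. The constant is `d (2π)^(-d/2)` times the
  -- volume of the unit ball, which simplifies by `Γ(d/2 + 1) = (d/2) Γ(d/2)`.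
  rw [chiTail_eq_integral_pi, integral_fun_norm_addHaar]
  simp only [finrank_euclideanSpace, Fintype.card_fin, nsmul_eq_mul, smul_eq_mul]
  have hI : ∫ y in Set.Ioi (0 : ℝ), y ^ (d - 1) *
      (Set.Ioi u).indicator (fun r => (√(2 * Real.pi))⁻¹ ^ d * Real.exp (-r ^ 2 / 2)) y =
      (√(2 * Real.pi))⁻¹ ^ d * ∫ r in Set.Ioi u, r ^ (d - 1) * Real.exp (-r ^ 2 / 2) := by
    rw [← integral_const_mul, ← integral_indicator measurableSet_Ioi,
      ← integral_indicator measurableSet_Ioi]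
    congr 1 with y
    simp only [Set.indicator, Set.mem_Ioi]
    split_ifs with h1 h2 h2
    · ring
    · simp
    · exact absurd (hu.trans_lt h2) h1
    · rfl
  rw [hI, measureReal_def, EuclideanSpace.volume_ball]
  have hG : 0 < Real.Gamma ((d : ℝ) / 2) := Real.Gamma_pos_of_pos (by positivity)
  simp only [ENNReal.ofReal_one, one_pow, one_mul, Fintype.card_fin]
  rw [ENNReal.toReal_ofReal (by
    have := Real.Gamma_pos_of_pos (show (0 : ℝ) < d / 2 + 1 by positivity)
    positivity), Real.Gamma_add_one (by positivity), chiConst, Real.sqrt_mul (by norm_num)]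
  have h2 : (2 : ℝ) ^ (1 - (d : ℝ) / 2) = 2 * (√2)⁻¹ ^ d := by
    rw [Real.rpow_sub (by norm_num), Real.rpow_one, inv_pow, div_eq_mul_inv, Real.sqrt_eq_rpow,
      ← Real.rpow_natCast, ← Real.rpow_mul (by norm_num)]
    ring_nf
  have hpi : √Real.pi ≠ 0 := (Real.sqrt_pos.2 Real.pi_pos).ne'
  rw [h2, mul_inv, mul_pow, inv_pow (√Real.pi)]
  field_simp

lemma integrable_pow_mul_exp_neg_sq (m : ℕ) :
    Integrable (fun r : ℝ => r ^ m * Real.exp (-r ^ 2 / 2)) := by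
  have h := integrable_rpow_mul_exp_neg_mul_sq (b := 1 / 2) (by norm_num) (s := m)
    (by have : (0 : ℝ) ≤ m := by positivity
        linarith)
  refine h.congr (ae_of_all _ fun r => ?_)
  simp only [Real.rpow_natCast]
  ring_nf

/-- Integer exponents are needed because `d - 2` is negative for `d = 1`. -/
lemma tendsto_zpow_mul_exp_neg_sq (m : ℤ) {b : ℝ} (hb : 0 < b) :
    Tendsto (fun u : ℝ => u ^ m * Real.exp (-(b * u ^ 2))) atTop (𝓝 0) := by
  have h := (tendsto_rpow_mul_exp_neg_mul_atTop_nhds_zero ((m : ℝ) / 2) b hb).comp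
    (tendsto_pow_atTop (α := ℝ) two_ne_zero)
  refine h.congr' ?_
  filter_upwards [eventually_gt_atTop 0] with u hu
  simp only [Function.comp]
  rw [← Real.rpow_natCast, ← Real.rpow_mul hu.le, ← Real.rpow_intCast]
  congr 2
  · push_cast; ring
  · simp

/-- By l'Hôpital's rule: the quotient of the derivatives is `1 / (1 - (d - 2) / u ^ 2)`. -/
lemma tendsto_integral_Ioi_div (d : ℕ) (hd : 1 ≤ d) :
    Tendsto (fun u : ℝ => (∫ r in Set.Ioi u, r ^ (d - 1) * Real.exp (-r ^ 2 / 2)) /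
      (u ^ ((d : ℤ) - 2) * Real.exp (-u ^ 2 / 2))) atTop (𝓝 1) := by
  have hint := integrable_pow_mul_exp_neg_sq (d - 1)
  have hcont : Continuous fun r : ℝ => r ^ (d - 1) * Real.exp (-r ^ 2 / 2) := by fun_prop
  have h1 : (fun u : ℝ => ∫ r in Set.Ioi u, r ^ (d - 1) * Real.exp (-r ^ 2 / 2)) =
      fun u => (∫ r in Set.Ioi (0 : ℝ), r ^ (d - 1) * Real.exp (-r ^ 2 / 2)) -
        ∫ r in (0 : ℝ)..u, r ^ (d - 1) * Real.exp (-r ^ 2 / 2) := by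
    ext v
    rw [← intervalIntegral.integral_Ioi_sub_Ioi' hint.integrableOn hint.integrableOn]
    ring
  have hf (u : ℝ) : HasDerivAt (fun u : ℝ => ∫ r in Set.Ioi u, r ^ (d - 1) * Real.exp (-r ^ 2 / 2))
      (-(u ^ (d - 1) * Real.exp (-u ^ 2 / 2))) u := by
    rw [h1]
    exact (intervalIntegral.integral_hasDerivAt_right (hcont.intervalIntegrable _ _)
      (hcont.stronglyMeasurableAtFilter _ _) hcont.continuousAt).const_sub _
  have hg : ∀ᶠ u : ℝ in atTop, HasDerivAt
      (fun u : ℝ => u ^ ((d : ℤ) - 2) * Real.exp (-u ^ 2 / 2))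
      (-(u ^ (d - 1) * Real.exp (-u ^ 2 / 2)) * (1 - ((d : ℝ) - 2) * (u ^ 2)⁻¹)) u := by
    filter_upwards [eventually_gt_atTop 0] with u hu
    have h1 := hasDerivAt_zpow ((d : ℤ) - 2) u (Or.inl hu.ne')
    have h2 : HasDerivAt (fun u : ℝ => Real.exp (-u ^ 2 / 2)) (Real.exp (-u ^ 2 / 2) * -u) u := by
      refine HasDerivAt.exp ?_
      convert! ((hasDerivAt_pow 2 u).neg.div_const 2) using 1
      simp only [Nat.cast_ofNat, Nat.add_one_sub_one, pow_one]
      ring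
    convert! h1.mul h2 using 1
    have e1 : u ^ (d - 1) = u ^ ((d : ℤ) - 2) * u := by
      rw [← zpow_natCast, ← zpow_add_one₀ hu.ne']
      congr 1
      omega
    have e2 : u ^ ((d : ℤ) - 2) = u ^ ((d : ℤ) - 2 - 1) * u := by
      rw [← zpow_add_one₀ hu.ne']; congr 1; ring
    rw [e1, e2]
    push_cast
    field_simp
    ring
  have hlim : Tendsto (fun u : ℝ => 1 - ((d : ℝ) - 2) * (u ^ 2)⁻¹) atTop (𝓝 1) := by
    have := ((tendsto_pow_atTop (α := ℝ) two_ne_zero).inv_tendsto_atTop).const_mul ((d : ℝ) - 2)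
    simpa using this.const_sub 1
  refine HasDerivAt.lhopital_zero_atTop (Eventually.of_forall hf) hg ?_ ?_ ?_ ?_
  · filter_upwards [eventually_gt_atTop 0, hlim.eventually_ne one_ne_zero] with u hu h
    exact mul_ne_zero (neg_ne_zero.2 (by positivity)) h
  · rw [h1]
    have h2 := (intervalIntegral_tendsto_integral_Ioi 0 hint.integrableOn tendsto_id).const_sub
      (∫ r in Set.Ioi (0 : ℝ), r ^ (d - 1) * Real.exp (-r ^ 2 / 2))
    rwa [sub_self] at h2
  · refine (tendsto_zpow_mul_exp_neg_sq ((d : ℤ) - 2) (b := 1 / 2) (by norm_num)).congr fun u => ?_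
    ring_nf
  · have := hlim.inv₀ one_ne_zero
    rw [inv_one] at this
    refine this.congr' ?_
    filter_upwards [eventually_gt_atTop 0] with u hu
    rw [div_mul_eq_div_div, div_self (neg_ne_zero.2 (by positivity)), one_div]

lemma tendsto_chiTail_div {d : ℕ} (hd : 1 ≤ d) :
    Tendsto (fun u : ℝ => chiTail d u / (u ^ ((d : ℤ) - 2) * Real.exp (-u ^ 2 / 2))) atTop
      (𝓝 (chiConst d)) := by
  have h := (tendsto_integral_Ioi_div d hd).const_mul (chiConst d)
  rw [mul_one] at h
  refine h.congr' ?_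
  filter_upwards [eventually_ge_atTop 0] with u hu
  rw [chiTail_eq_integral hd hu, mul_div_assoc]

/-- Giving up part of the exponent absorbs the power of `u` and the constant. -/
lemma eventually_chiTail_le {d : ℕ} (hd : 1 ≤ d) {θ : ℝ} (hθ : θ < 1) :
    ∀ᶠ u in atTop, chiTail d u ≤ Real.exp (-(θ * u ^ 2 / 2)) := by
  have h := (tendsto_chiTail_div hd).mul
    (tendsto_zpow_mul_exp_neg_sq ((d : ℤ) - 2) (b := (1 - θ) / 2) (by linarith))
  rw [mul_zero] at h
  filter_upwards [h.eventually_le_const one_pos, eventually_gt_atTop 0] with u hu hu0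
  have e : chiTail d u / (u ^ ((d : ℤ) - 2) * Real.exp (-u ^ 2 / 2)) *
      (u ^ ((d : ℤ) - 2) * Real.exp (-((1 - θ) / 2 * u ^ 2))) =
      chiTail d u / Real.exp (-(θ * u ^ 2 / 2)) := by
    have : Real.exp (-((1 - θ) / 2 * u ^ 2)) =
        Real.exp (-u ^ 2 / 2) / Real.exp (-(θ * u ^ 2 / 2)) := by
      rw [← Real.exp_sub]; ring_nf
    rw [this]
    field_simp
  rw [e, div_le_one (Real.exp_pos _)] at hu
  exact hu

/-! ### Normalized levels and their tail probabilities. -/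

/-- The normalized level `a_n⁻¹ x + b_n`. -/
noncomputable def chiLevel (d : ℕ) (x : ℝ) (n : ℕ) : ℝ := (chiA n)⁻¹ * x + chiB d n

lemma tendsto_chiA : Tendsto chiA atTop atTop :=
  Real.tendsto_sqrt_atTop.comp
    ((Real.tendsto_log_atTop.comp tendsto_natCast_atTop_atTop).const_mul_atTop two_pos)

lemma chiA_sq {n : ℕ} (hn : 1 ≤ n) : chiA n ^ 2 = 2 * Real.log n :=
  Real.sq_sqrt (mul_nonneg two_pos.le (Real.log_nonneg (by exact_mod_cast hn)))

/-- The offset `a_n (u_n(x) - a_n)`. -/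
noncomputable def chiOffset (d : ℕ) (x : ℝ) (n : ℕ) : ℝ :=
  x + Real.log (chiConst d * chiA n ^ ((d : ℤ) - 2))

lemma chiLevel_eq (d : ℕ) (x : ℝ) (n : ℕ) :
    chiLevel d x n = chiA n + chiOffset d x n / chiA n := by
  simp only [chiLevel, chiB, chiOffset, chiConst]
  ring

lemma tendsto_chiOffset_div {d : ℕ} (hd : 1 ≤ d) (x : ℝ) :
    Tendsto (fun n => chiOffset d x n / chiA n) atTop (𝓝 0) := by
  have h1 : Tendsto (fun a : ℝ => (x + Real.log (chiConst d)) * a⁻¹ +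
      ((d : ℝ) - 2) * (Real.log a / a)) atTop (𝓝 0) := by
    have h2 : Tendsto (fun a : ℝ => Real.log a / a) atTop (𝓝 0) := by
      simpa using Real.tendsto_pow_log_div_mul_add_atTop 1 0 1 one_ne_zero
    simpa using (tendsto_inv_atTop_zero.const_mul (x + Real.log (chiConst d))).add
      (h2.const_mul ((d : ℝ) - 2))
  refine (h1.comp tendsto_chiA).congr' ?_
  filter_upwards [tendsto_chiA.eventually_gt_atTop 0] with n hn
  simp only [Function.comp, chiOffset]
  rw [Real.log_mul (chiConst_pos hd).ne' (zpow_pos hn _).ne', Real.log_zpow]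
  push_cast
  ring

lemma tendsto_chiLevel_div {d : ℕ} (hd : 1 ≤ d) (x : ℝ) :
    Tendsto (fun n => chiLevel d x n / chiA n) atTop (𝓝 1) := by
  have h := ((tendsto_chiOffset_div hd x).mul tendsto_chiA.inv_tendsto_atTop).const_add 1
  rw [mul_zero, add_zero] at h
  refine h.congr' ?_
  filter_upwards [tendsto_chiA.eventually_gt_atTop 0] with n hn
  rw [chiLevel_eq]
  simp only [Pi.inv_apply]
  field_simp

lemma tendsto_chiLevel {d : ℕ} (hd : 1 ≤ d) (x : ℝ) :
    Tendsto (chiLevel d x) atTop atTop := by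
  have h := tendsto_chiA.atTop_mul_pos one_pos (tendsto_chiLevel_div hd x)
  refine h.congr' ?_
  filter_upwards [tendsto_chiA.eventually_gt_atTop 0] with n hn
  field_simp

/-- With `o` the offset, `u_n = a_n + o / a_n`, so `u_n² / 2 = a_n² / 2 + o + (o / a_n)² / 2`. Here
`exp(-a_n² / 2) = 1/n`, `exp(-o)` is `exp(-x)` divided by the prefactor of the tail at `a_n`, and
the last term vanishes since `o` is of order `log a_n` at most. -/
lemma tendsto_nat_mul_chiTail {d : ℕ} (hd : 1 ≤ d) (x : ℝ) :
    Tendsto (fun n : ℕ => n * chiTail d (chiLevel d x n)) atTop (𝓝 (Real.exp (-x))) := by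
  have h1 := (tendsto_chiTail_div hd).comp (tendsto_chiLevel hd x)
  have h2 := (tendsto_chiLevel_div hd x).zpow₀ ((d : ℤ) - 2) (Or.inl one_ne_zero)
  have h3 : Tendsto (fun n => Real.exp (-(chiOffset d x n / chiA n) ^ 2 / 2)) atTop (𝓝 1) := by
    have := (((tendsto_chiOffset_div hd x).pow 2).neg.div_const 2).rexp
    simpa using this
  have h := (h1.mul (h2.mul h3)).mul_const (Real.exp (-x) / chiConst d)
  have hc := (chiConst_pos hd).ne'
  rw [one_zpow, mul_one, mul_one, mul_div_cancel₀ _ hc] at h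
  refine h.congr' ?_
  filter_upwards [tendsto_chiA.eventually_gt_atTop 0, eventually_ge_atTop 1,
    (tendsto_chiLevel hd x).eventually_gt_atTop 0] with n hn hn1 hu
  have hn0 : (0 : ℝ) < n := by exact_mod_cast hn1
  have hexp : Real.exp (-chiLevel d x n ^ 2 / 2) = (n : ℝ)⁻¹ * (Real.exp (-x) *
      (chiConst d * chiA n ^ ((d : ℤ) - 2))⁻¹ *
        Real.exp (-(chiOffset d x n / chiA n) ^ 2 / 2)) := by
    have hpos : 0 < chiConst d * chiA n ^ ((d : ℤ) - 2) :=
      mul_pos (chiConst_pos hd) (zpow_pos hn _)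
    have hz : (chiConst d * chiA n ^ ((d : ℤ) - 2))⁻¹ =
        Real.exp (-(chiOffset d x n - x)) := by
      rw [chiOffset, add_sub_cancel_left, Real.exp_neg, Real.exp_log hpos]
    have hn' : (n : ℝ)⁻¹ = Real.exp (-(chiA n ^ 2 / 2)) := by
      rw [chiA_sq hn1, mul_div_cancel_left₀ _ two_ne_zero, Real.exp_neg, Real.exp_log hn0]
    rw [hz, hn', ← Real.exp_add, ← Real.exp_add, ← Real.exp_add, chiLevel_eq]
    congr 1
    field_simp
    ring
  simp only [Function.comp]
  rw [hexp, div_zpow]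
  have := (zpow_pos hn ((d : ℤ) - 2)).ne'
  have := (zpow_pos hu ((d : ℤ) - 2)).ne'
  field_simp

/-! ### Decoupling by resampling one vector. -/

section Decoupling

variable {Ω E : Type*} [MeasurableSpace Ω] {P : Measure Ω} [IsProbabilityMeasure P]

lemma ProbabilityTheory.IndepFun.measureReal_prod_eq {α β : Type*} [MeasurableSpace α]
    [MeasurableSpace β] {X : Ω → α} {W : Ω → β} (hX : Measurable X) (hW : Measurable W)
    (h : IndepFun X W P) {S : Set (α × β)} (hS : MeasurableSet S) :
    (P.prod P).real {p | (X p.1, W p.2) ∈ S} = P.real {ω | (X ω, W ω) ∈ S} := by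
  have h1 := (indepFun_iff_map_prod_eq_prod_map_map hX.aemeasurable hW.aemeasurable).1 h
  rw [Measure.map_prod_map _ _ hX hW] at h1
  have h2 := congrArg (fun μ => μ.real S) h1
  simp only [map_measureReal_apply (hX.prodMk hW) hS,
    map_measureReal_apply (hX.prodMap hW) hS] at h2
  exact h2.symm

variable [NormedAddCommGroup E] [NormedSpace ℝ E]

/-- If `V l - c l • X` is independent of `X`, then on a product space `X` may be replaced by an
independent copy of itself; the events on which this changes an exceedance control the dependence
of `‖X‖ ≤ s` on `‖V l‖ ≤ t l`. -/
lemma abs_measureReal_inter_sub_le_sum [MeasurableSpace E] [BorelSpace E]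
    [SecondCountableTopology E] {ι : Type*} {X : Ω → E} {V : ι → Ω → E} {c : ι → ℝ}
    (hX : Measurable X) (hV : ∀ l, Measurable (V l))
    (h : IndepFun X (fun ω l => V l ω - c l • X ω) P) (J : Finset ι) (t : ι → ℝ) (s : ℝ) :
    |P.real ({ω | ‖X ω‖ ≤ s} ∩ {ω | ∀ l ∈ J, ‖V l ω‖ ≤ t l}) -
      P.real {ω | ‖X ω‖ ≤ s} * P.real {ω | ∀ l ∈ J, ‖V l ω‖ ≤ t l}| ≤
    ∑ l ∈ J, (P.prod P).real {p | s < ‖X p.1‖ ∧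
      ¬ (t l < ‖V l p.2‖ ↔ t l < ‖V l p.2 - c l • X p.2 + c l • X p.1‖)} := by
  set A := {ω | ‖X ω‖ ≤ s}
  set B := {ω | ∀ l ∈ J, ‖V l ω‖ ≤ t l}
  have hA : MeasurableSet A := measurableSet_le hX.norm measurable_const
  have hB : MeasurableSet B := by
    simp only [B, Set.ofPred_forall]
    exact J.measurableSet_biInter fun l _ => measurableSet_le (hV l).norm measurable_const
  have hS : MeasurableSet {q : E × (ι → E) | s < ‖q.1‖ ∧ ∀ l ∈ J, ‖q.2 l + c l • q.1‖ ≤ t l} := by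
    refine (measurableSet_lt measurable_const measurable_fst.norm).inter ?_
    have e : {q : E × (ι → E) | ∀ l ∈ J, ‖q.2 l + c l • q.1‖ ≤ t l} =
        ⋂ l ∈ J, {q | ‖q.2 l + c l • q.1‖ ≤ t l} := by ext; simp
    change MeasurableSet {q : E × (ι → E) | ∀ l ∈ J, ‖q.2 l + c l • q.1‖ ≤ t l}
    rw [e]
    refine J.measurableSet_biInter fun l _ => measurableSet_le ?_ measurable_const
    have : Measurable fun q : E × (ι → E) => q.2 l := (measurable_pi_apply l).comp measurable_snd
    fun_prop
  have hW : Measurable fun ω l => V l ω - c l • X ω :=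
    measurable_pi_lambda _ fun l => (hV l).sub (hX.const_smul (c l))
  have h1 := h.measureReal_prod_eq hX hW hS
  have e1 : {ω | (X ω, fun l => V l ω - c l • X ω) ∈
      {q : E × (ι → E) | s < ‖q.1‖ ∧ ∀ l ∈ J, ‖q.2 l + c l • q.1‖ ≤ t l}} = B \ A := by
    ext ω
    simp [A, B, and_comm]
  rw [e1] at h1
  -- Passing to `Aᶜ` places both events inside `s < ‖X p.1‖`. This rare factor, of order `1/n` in
  -- the application, is what allows summing over the `n²` pairs.
  have h2 : P.real (A ∩ B) - P.real A * P.real B =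
      (P.prod P).real (Aᶜ ×ˢ B) - P.real (B \ A) := by
    rw [measureReal_prod_prod, probReal_compl_eq_one_sub hA, Set.inter_comm,
      ← measureReal_inter_add_sdiff (μ := P) (s := B) hA]
    ring
  rw [h2, ← h1]
  refine (abs_measureReal_sub_le_measureReal_symmDiff (hA.compl.prod hB).nullMeasurableSet
    ?_).trans ?_
  · exact (hS.preimage
      ((hX.comp measurable_fst).prodMk (hW.comp measurable_snd))).nullMeasurableSet
  refine le_trans (measureReal_mono ?_ (measure_ne_top _ _)) (measureReal_biUnion_finset_le J _)
  rintro ⟨ω, ω'⟩ hω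
  simp only [Set.mem_symmDiff, Set.mem_prod, Set.mem_compl_iff, A, B, Set.mem_ofPred_eq, not_le,
    not_and, not_forall] at hω
  simp only [Set.mem_iUnion, Set.mem_ofPred_eq]
  rcases hω with ⟨⟨hs, hb⟩, hn⟩ | ⟨⟨hs, hb⟩, hn⟩
  · obtain ⟨l, hl, hlt⟩ := hn hs
    exact ⟨l, hl, hs, fun hiff => absurd (hiff.2 hlt) (hb l hl).not_gt⟩
  · obtain ⟨l, hl, hlt⟩ := hn hs
    exact ⟨l, hl, hs, fun hiff => absurd (hiff.1 hlt) (hb l hl).not_gt⟩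

variable {X V : Ω → E} {G : ℝ → ℝ}

/-- Used for short lags. Either `V p.2` already exceeds `u`, which is independent of `X p.1`, or the
resampled vector exceeds `t`. In the latter case, unless `‖X p.1‖ > (1 + η) u`, the triangle
inequality leaves at least `(1 - ρ (1 + η)) u` to be shared by `‖V p.2‖` and `‖X p.2‖`, so one of
them exceeds half of that. -/
lemma measureReal_exceedance_change_le_of_abs_le (hGX : ∀ u, P.real {ω | u < ‖X ω‖} = G u)
    (hGV : ∀ u, P.real {ω | u < ‖V ω‖} = G u) {u s t c ρ η : ℝ} (hs : u ≤ s)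
    (ht : u ≤ t) (hc : |c| ≤ ρ) (hρ : ρ ≤ 1) :
    (P.prod P).real {p | s < ‖X p.1‖ ∧ ¬ (t < ‖V p.2‖ ↔ t < ‖V p.2 - c • X p.2 + c • X p.1‖)} ≤
      G u * G u + G ((1 + η) * u) + 2 * (G u * G ((1 - ρ * (1 + η)) * u / 2)) := by
  set a := (1 - ρ * (1 + η)) * u / 2
  have hsub : {p : Ω × Ω | s < ‖X p.1‖ ∧
      ¬ (t < ‖V p.2‖ ↔ t < ‖V p.2 - c • X p.2 + c • X p.1‖)} ⊆
      ({ω | u < ‖X ω‖} ×ˢ {ω | u < ‖V ω‖} ∪ {ω | (1 + η) * u < ‖X ω‖} ×ˢ Set.univ) ∪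
      ({ω | u < ‖X ω‖} ×ˢ {ω | a < ‖V ω‖} ∪ {ω | u < ‖X ω‖} ×ˢ {ω | a < ‖X ω‖}) := by
    rintro p ⟨h1, h2⟩
    by_contra hcon
    simp only [Set.mem_union, Set.mem_prod, Set.mem_univ, Set.mem_ofPred_eq, not_or, not_and,
      not_lt, and_true] at hcon
    obtain ⟨⟨c1, c2⟩, c3, c4⟩ := hcon
    have hx := hs.trans_lt h1
    have c1 := c1 hx
    have c3 := c3 hx
    have c4 := c4 hx
    have h3 : t < ‖V p.2 - c • X p.2 + c • X p.1‖ := by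
      by_contra h3
      exact h2 ⟨fun h4 => absurd (c1.trans ht) h4.not_ge, fun h4 => absurd h4 h3⟩
    have h4 := norm_add_le (V p.2 - c • X p.2) (c • X p.1)
    have h5 := norm_sub_le (V p.2) (c • X p.2)
    rw [norm_smul, Real.norm_eq_abs] at h4 h5
    have hρ0 := (abs_nonneg c).trans hc
    have h6 : |c| * ‖X p.1‖ ≤ ρ * ((1 + η) * u) := by gcongr
    have h7 : |c| * ‖X p.2‖ ≤ 1 * ‖X p.2‖ := by gcongr; exact hc.trans hρ
    simp only [a] at c3 c4
    linarith
  refine (measureReal_mono hsub).trans ((measureReal_union_le _ _).trans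
    ((add_le_add (measureReal_union_le _ _) (measureReal_union_le _ _)).trans ?_))
  simp only [measureReal_prod_prod, hGX, hGV, probReal_univ]
  linarith

/-- Used for long lags. Unless one of the two copies of `X` has norm above `2 u`, resampling moves
`V` by at most `4 |c| u ≤ δ`, so a change forces `‖V‖` to lie within `δ` of `t`. -/
lemma measureReal_exceedance_change_le_of_mul_le [MeasurableSpace E] [BorelSpace E]
    (hV : Measurable V)
    (hGX : ∀ u, P.real {ω | u < ‖X ω‖} = G u)
    (hGV : ∀ u, P.real {ω | u < ‖V ω‖} = G u) {u s t c δ : ℝ} (hs : u ≤ s)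
    (hc : 4 * |c| * u ≤ δ) (hδ : 0 ≤ δ) :
    (P.prod P).real {p | s < ‖X p.1‖ ∧ ¬ (t < ‖V p.2‖ ↔ t < ‖V p.2 - c • X p.2 + c • X p.1‖)} ≤
      G (2 * u) + G u * G (2 * u) + G u * (G (t - δ) - G (t + δ)) := by
  have hsub : {p : Ω × Ω | s < ‖X p.1‖ ∧
      ¬ (t < ‖V p.2‖ ↔ t < ‖V p.2 - c • X p.2 + c • X p.1‖)} ⊆
      ({ω | 2 * u < ‖X ω‖} ×ˢ Set.univ ∪ {ω | u < ‖X ω‖} ×ˢ {ω | 2 * u < ‖X ω‖}) ∪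
      {ω | u < ‖X ω‖} ×ˢ {ω | t - δ < ‖V ω‖ ∧ ‖V ω‖ ≤ t + δ} := by
    rintro p ⟨h1, h2⟩
    by_contra hcon
    simp only [Set.mem_union, Set.mem_prod, Set.mem_univ, Set.mem_ofPred_eq, not_or, not_and,
      not_lt, and_true, not_le] at hcon
    obtain ⟨⟨c1, c2⟩, c3⟩ := hcon
    have hx := hs.trans_lt h1
    have c2 := c2 hx
    have c3 := c3 hx
    have h4 := norm_sub_norm_le (V p.2 - c • X p.2 + c • X p.1) (V p.2)
    have h4' := norm_sub_norm_le (V p.2) (V p.2 - c • X p.2 + c • X p.1)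
    rw [norm_sub_rev] at h4'
    have h5 : V p.2 - c • X p.2 + c • X p.1 - V p.2 = c • (X p.1 - X p.2) := by
      rw [smul_sub]; abel
    have h6 : ‖c • (X p.1 - X p.2)‖ ≤ δ := by
      rw [norm_smul, Real.norm_eq_abs]
      have := norm_sub_le (X p.1) (X p.2)
      calc |c| * ‖X p.1 - X p.2‖ ≤ |c| * (4 * u) := by gcongr; linarith
        _ ≤ δ := by linarith
    rw [h5] at h4 h4'
    refine h2 ⟨fun h7 => ?_, fun h7 => ?_⟩
    · have := c3 (by linarith)
      linarith
    · exact (le_of_not_gt fun h8 => (c3 (by linarith)).not_ge (by linarith)).lt_of_ne fun h8 => by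
        have := c3 (by linarith)
        linarith
  refine (measureReal_mono hsub).trans ((measureReal_union_le _ _).trans
    ((add_le_add_left (measureReal_union_le _ _) _).trans ?_))
  have hdiff : P.real {ω | t - δ < ‖V ω‖ ∧ ‖V ω‖ ≤ t + δ} = G (t - δ) - G (t + δ) := by
    rw [← hGV, ← hGV, ← measureReal_sdiff]
    · congr 1 with ω
      simp
    · intro ω hω
      simp only [Set.mem_ofPred_eq] at hω ⊢
      linarith
    · exact measurableSet_lt measurable_const hV.norm
  simp only [measureReal_prod_prod, hGX, hdiff, probReal_univ, mul_one, le_refl]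

/-- Telescoping: if each event is nearly independent of every intersection of earlier ones, the
probability of the intersection is nearly the product. -/
lemma abs_measureReal_forall_sub_prod_le {A : ℕ → Set Ω} {δ : ℝ} (I : Finset ℕ)
    (h : ∀ k ∈ I, ∀ J ⊆ I, (∀ l ∈ J, l < k) →
      |P.real (A k ∩ {ω | ∀ l ∈ J, ω ∈ A l}) - P.real (A k) * P.real {ω | ∀ l ∈ J, ω ∈ A l}| ≤ δ) :
    |P.real {ω | ∀ k ∈ I, ω ∈ A k} - ∏ k ∈ I, P.real (A k)| ≤ I.card * δ := by
  induction I using Finset.induction_on_max with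
  | empty => simp
  | insert k J hJ ih =>
    have hk : k ∉ J := fun hk => (hJ k hk).false
    have h1 := h k (Finset.mem_insert_self _ _) J (Finset.subset_insert _ _) hJ
    have h2 := ih fun k' hk' J' hJ' => h k' (Finset.mem_insert_of_mem hk') J'
      (hJ'.trans (Finset.subset_insert _ _))
    have e : {ω | ∀ l ∈ insert k J, ω ∈ A l} = A k ∩ {ω | ∀ l ∈ J, ω ∈ A l} := by
      ext ω; simp
    rw [e, Finset.prod_insert hk, Finset.card_insert_of_notMem hk]
    have h3 : |P.real (A k) * (P.real {ω | ∀ l ∈ J, ω ∈ A l} - ∏ l ∈ J, P.real (A l))| ≤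
        1 * (J.card * δ) := by
      rw [abs_mul, abs_of_nonneg measureReal_nonneg]
      exact mul_le_mul measureReal_le_one h2 (abs_nonneg _) one_pos.le
    push_cast
    calc _ = |(P.real (A k ∩ {ω | ∀ l ∈ J, ω ∈ A l}) -
            P.real (A k) * P.real {ω | ∀ l ∈ J, ω ∈ A l}) +
          P.real (A k) * (P.real {ω | ∀ l ∈ J, ω ∈ A l} - ∏ l ∈ J, P.real (A l))| := by ring_nf
      _ ≤ _ := (abs_add_le _ _).trans (by linarith)

end Decoupling

/-! ### Copies of the Gaussian sequence and bounds on its correlations. -/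

lemma IsStdGaussianSeq.of_isCopy {Ω₀ Ω : Type*} [MeasurableSpace Ω₀] [MeasurableSpace Ω]
    {P₀ : Measure Ω₀} {P : Measure Ω} {Y : ℕ → Ω₀ → ℝ} {r : ℕ → ℝ}
    {Z : ℕ → Ω → ℝ} (hY : IsStdGaussianSeq Y r P₀) (h : IsCopy Z P Y P₀) :
    IsStdGaussianSeq Z r P where
  gaussian := ⟨fun I => ⟨by
    have h1 := (h.comp (Finset.measurable_restrict (X := fun _ : ℕ => ℝ) I)).map_eq
    have h2 := (hY.gaussian.hasGaussianLaw I).isGaussian_map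
    simp only [Function.comp_def] at h1
    rwa [h1]⟩⟩
  standard k := by
    have h1 := h.comp (measurable_pi_apply (X := fun _ : ℕ => ℝ) k)
    exact ⟨h1.aemeasurable_fst, h1.map_eq.trans (hY.standard k).map_eq⟩
  covariance k n := by
    rw [← hY.covariance k n]
    have hk := (measurable_pi_apply (X := fun _ : ℕ => ℝ) k).aestronglyMeasurable
      (μ := P.map fun ω k => Z k ω)
    have hn := (measurable_pi_apply (X := fun _ : ℕ => ℝ) (k + n)).aestronglyMeasurable
      (μ := P.map fun ω k => Z k ω)
    have h1 := covariance_map hk hn h.aemeasurable_fst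
    have h2 := covariance_map (h.map_eq ▸ hk) (h.map_eq ▸ hn) h.aemeasurable_snd
    rw [h.map_eq, h2] at h1
    exact h1.symm

section Correlation

variable {Ω : Type*} [MeasurableSpace Ω] {P : Measure Ω} {Y : ℕ → Ω → ℝ} {r : ℕ → ℝ}

lemma IsStdGaussianSeq.memLp (hY : IsStdGaussianSeq Y r P) (k : ℕ) : MemLp (Y k) 2 P :=
  (hY.gaussian.hasGaussianLaw_eval k).memLp_two

lemma IsStdGaussianSeq.covariance_dist (hY : IsStdGaussianSeq Y r P) (k l : ℕ) :
    cov[Y k, Y l; P] = r (Nat.dist k l) := by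
  rcases le_total k l with h | h
  · obtain ⟨n, rfl⟩ := Nat.exists_eq_add_of_le h
    rw [hY.covariance, Nat.dist_eq_sub_of_le h, Nat.add_sub_cancel_left]
  · obtain ⟨n, rfl⟩ := Nat.exists_eq_add_of_le h
    rw [covariance_comm, hY.covariance, Nat.dist_eq_sub_of_le_right h, Nat.add_sub_cancel_left]

lemma IsStdGaussianSeq.apply_zero (hY : IsStdGaussianSeq Y r P) : r 0 = 1 := by
  rw [← hY.covariance 0 0, add_zero, covariance_self (hY.standard 0).aemeasurable,
    (hY.standard 0).variance_eq, variance_id_gaussianReal]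
  rfl

/-- The variance of `Y (k + m) - r m * Y k` is `1 - r m ^ 2 ≤ 0`, so this variable is almost surely
constant and uncorrelated with `Y 0`. -/
lemma IsStdGaussianSeq.apply_add_of_one_le_sq [IsProbabilityMeasure P]
    (hY : IsStdGaussianSeq Y r P) {m : ℕ}
    (hm : 1 ≤ r m ^ 2) (k : ℕ) : r (k + m) = r m * r k := by
  have h0 := hY.memLp 0
  have h1 := hY.memLp (k + m)
  have h2 := (hY.memLp k).const_mul (r m)
  have hv : Var[fun ω => Y (k + m) ω - r m * Y k ω; P] = 0 := by
    refine le_antisymm ?_ (variance_nonneg _ _)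
    have hm' := (h1.sub h2).aemeasurable
    rw [← covariance_self (X := fun ω => Y (k + m) ω - r m * Y k ω) hm',
      covariance_fun_sub_fun_sub h1 h2 h1 h2, covariance_const_mul_left,
      covariance_const_mul_right, covariance_const_mul_left, covariance_const_mul_right,
      hY.covariance k m, covariance_comm (Y (k + m)) (Y k), hY.covariance k m,
      hY.covariance_dist, hY.covariance_dist, Nat.dist_self, Nat.dist_self, hY.apply_zero]
    nlinarith
  have hc : cov[Y 0, fun ω => Y (k + m) ω - r m * Y k ω; P] = 0 := by
    refine integral_eq_zero_of_ae ?_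
    filter_upwards [ae_eq_integral_of_variance_eq_zero (h1.sub h2) hv] with ω hω
    simp only [Pi.sub_apply] at hω
    simp [hω]
  rw [covariance_fun_sub_right h0 h1 h2, covariance_const_mul_right, hY.covariance_dist,
    hY.covariance_dist, Nat.dist_zero_left, Nat.dist_zero_left] at hc
  linarith

/-- Otherwise the preceding recursion keeps `|r|` at least 1 along all multiples of `m`, against `r
→ 0`. -/
lemma IsStdGaussianSeq.abs_lt_one [IsProbabilityMeasure P]
    (hY : IsStdGaussianSeq Y r P) (hr : Tendsto r atTop (𝓝 0))
    {m : ℕ} (hm : 1 ≤ m) : |r m| < 1 := by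
  by_contra! h
  have h2 : 1 ≤ r m ^ 2 := by rwa [one_le_sq_iff_one_le_abs]
  have h3 (j : ℕ) : 1 ≤ |r (j * m)| := by
    induction j with
    | zero => simp [hY.apply_zero]
    | succ j ih =>
      rw [Nat.succ_mul, hY.apply_add_of_one_le_sq h2, abs_mul]
      exact one_le_mul_of_one_le_of_one_le h ih
  have h4 := (hr.comp (tendsto_id.atTop_mul_const' hm)).abs
  rw [abs_zero] at h4
  exact absurd (ge_of_tendsto' h4 h3) (by norm_num)

/-- All but finitely many correlations are at most `1/2` in absolute value; the remaining ones are
strictly below 1. -/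
lemma IsStdGaussianSeq.exists_abs_le [IsProbabilityMeasure P]
    (hY : IsStdGaussianSeq Y r P) (hr : Tendsto r atTop (𝓝 0)) :
    ∃ ρ < 1, ∀ m, 1 ≤ m → |r m| ≤ ρ := by
  have h1 (M : ℕ) : ∃ ρ < 1, (1 / 2 : ℝ) ≤ ρ ∧ ∀ m, 1 ≤ m → m < M → |r m| ≤ ρ := by
    induction M with
    | zero => exact ⟨1 / 2, by norm_num, le_rfl, by simp⟩
    | succ M ih =>
      obtain ⟨ρ, h1, h2, h3⟩ := ih
      rcases Nat.eq_zero_or_pos M with rfl | hM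
      · exact ⟨ρ, h1, h2, fun m hm hm' => by omega⟩
      refine ⟨max ρ |r M|, max_lt h1 (hY.abs_lt_one hr hM), h2.trans (le_max_left _ _),
        fun m hm hm' => ?_⟩
      rcases Nat.lt_succ_iff_lt_or_eq.1 hm' with h | rfl
      · exact (h3 m hm h).trans (le_max_left _ _)
      · exact le_max_right _ _
  have h2 := hr.abs
  rw [abs_zero] at h2
  obtain ⟨M, hM⟩ := eventually_atTop.1 (h2.eventually_le_const (show (0 : ℝ) < 1 / 2 by norm_num))
  obtain ⟨ρ, h3, h4, h5⟩ := h1 M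
  exact ⟨ρ, h3, fun m hm => (lt_or_ge m M).elim (h5 m hm) fun h => (hM m h).trans h4⟩

end Correlation

/-! ### The Gaussian vectors whose norms form the chi sequence. -/

section Vector

variable {Ω : Type*} [MeasurableSpace Ω] {P : Measure Ω} {d : ℕ} {Z : Fin d → ℕ → Ω → ℝ} {r : ℕ → ℝ}

/-- The vector whose coordinates are the `k`-th terms of the `d` sequences. -/
noncomputable def vecSeq (Z : Fin d → ℕ → Ω → ℝ) (k : ℕ) (ω : Ω) : EuclideanSpace ℝ (Fin d) :=
  WithLp.toLp 2 fun j => Z j k ω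

omit [MeasurableSpace Ω] in
lemma chiSeq_eq_norm (k : ℕ) (ω : Ω) : chiSeq Z k ω = ‖vecSeq Z k ω‖ := by
  simp [chiSeq, vecSeq, EuclideanSpace.norm_eq]

lemma measurable_vecSeq (hZm : ∀ j k, Measurable (Z j k)) (k : ℕ) : Measurable (vecSeq Z k) :=
  (WithLp.measurable_toLp 2 _).comp (measurable_pi_lambda _ fun j => hZm j k)

lemma measureReal_lt_norm_vecSeq [IsProbabilityMeasure P] (hZm : ∀ j k, Measurable (Z j k))
    (hZ : ∀ j, IsStdGaussianSeq (Z j) r P) (hind : iIndepFun (fun j ω k => Z j k ω) P)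
    (k : ℕ) (u : ℝ) : P.real {ω | u < ‖vecSeq Z k ω‖} = chiTail d u := by
  have h1 := hind.comp (fun _ f => f k) fun _ => measurable_pi_apply k
  have h2 := (iIndepFun_iff_map_fun_eq_pi_map fun j => (hZm j k).aemeasurable).1 h1
  have h3 : P.map (vecSeq Z k) = stdGaussian (EuclideanSpace ℝ (Fin d)) := by
    rw [← map_pi_eq_stdGaussian, ← (funext fun j => (hZ j).standard k |>.map_eq :
      (fun j => P.map (Z j k)) = fun _ => gaussianReal 0 1), ← h2,
      Measure.map_map (WithLp.measurable_toLp 2 _) (measurable_pi_lambda _ fun j => hZm j k)]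
    rfl
  rw [chiTail, ← h3, map_measureReal_apply (measurable_vecSeq hZm k)
    (measurableSet_lt measurable_const measurable_norm)]
  rfl

lemma isGaussianProcess_uncurry (hZ : ∀ j, IsGaussianProcess (Z j) P)
    (hind : iIndepFun (fun j ω k => Z j k ω) P) :
    IsGaussianProcess (fun p : Fin d × ℕ => Z p.1 p.2) P where
  hasGaussianLaw I := by
    -- A finite set of pairs sits inside the rectangle of all `j` and the times `I'`, on which
    -- independence of the `d` Gaussian blocks gives joint Gaussianity.
    let I' := I.image Prod.snd
    have h1 : iIndepFun (fun j ω => I'.restrict (Z j · ω)) P :=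
      hind.comp (fun _ f => I'.restrict f) fun _ => I'.measurable_restrict
    have h2 := h1.hasGaussianLaw fun j => (hZ j).hasGaussianLaw I'
    let L : ((j : Fin d) → I' → ℝ) →L[ℝ] (I → ℝ) :=
      { toFun x p := x p.1.1 ⟨p.1.2, Finset.mem_image_of_mem _ p.2⟩
        map_add' _ _ := rfl
        map_smul' _ _ := rfl
        cont := by fun_prop }
    exact h2.map L

/-- Jointly Gaussian and uncorrelated families are independent. The coefficient is the regression
coefficient within each coordinate, and distinct coordinates are independent. -/
lemma indepFun_vecSeq_sub [IsProbabilityMeasure P] (hZm : ∀ j k, Measurable (Z j k))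
    (hZ : ∀ j, IsStdGaussianSeq (Z j) r P) (hind : iIndepFun (fun j ω k => Z j k ω) P) (k : ℕ) :
    IndepFun (vecSeq Z k)
      (fun ω l => vecSeq Z l ω - r (Nat.dist k l) • vecSeq Z k ω) P := by
  let V (p : Fin d × ℕ) (ω : Ω) := Z p.1 p.2 ω - r (Nat.dist k p.2) * Z p.1 k ω
  have hG : IsGaussianProcess (Sum.elim (fun j => Z j k) V) P := by
    refine IsGaussianProcess.of_isGaussianProcess
      (isGaussianProcess_uncurry (fun j => (hZ j).gaussian) hind) ?_
    rintro (j | ⟨j, l⟩)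
    · exact ⟨{(j, k)}, .proj ⟨(j, k), by simp⟩, fun ω => rfl⟩
    · exact ⟨{(j, k), (j, l)}, .proj ⟨(j, l), by simp⟩ -
        r (Nat.dist k l) • .proj ⟨(j, k), by simp⟩, fun ω => rfl⟩
  have hV : ∀ p, Measurable (V p) := fun p => (hZm _ _).sub ((hZm _ _).const_mul _)
  have h := hG.indepFun_of_covariance_eq_zero (fun j => (hZm j k).aemeasurable)
    (fun p => (hV p).aemeasurable) fun i ⟨j, l⟩ => by
      rw [covariance_fun_sub_right ((hZ i).memLp k) ((hZ j).memLp l)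
        (((hZ j).memLp k).const_mul _), covariance_const_mul_right]
      by_cases hij : i = j
      · subst hij
        rw [(hZ i).covariance_dist, (hZ i).covariance_dist, Nat.dist_self, (hZ i).apply_zero]
        ring
      · have h0 (l : ℕ) : cov[Z i k, Z j l; P] = 0 :=
          ((hind.indepFun hij).comp (measurable_pi_apply k)
            (measurable_pi_apply l)).covariance_eq_zero ((hZ i).memLp k) ((hZ j).memLp l)
        rw [h0, h0]
        ring
  exact h.comp (WithLp.measurable_toLp 2 _) (ψ := fun f l => WithLp.toLp 2 fun j => f (j, l))
    (measurable_pi_lambda _ fun l => (WithLp.measurable_toLp 2 _).comp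
      (measurable_pi_lambda _ fun j => measurable_pi_apply _))

end Vector

/-! ### Error estimates for short and long lags. -/

section Levels

variable {d : ℕ}

lemma chiLevel_mono (d n : ℕ) {x y : ℝ} (h : x ≤ y) : chiLevel d x n ≤ chiLevel d y n := by
  have : 0 ≤ chiA n := Real.sqrt_nonneg _
  unfold chiLevel
  gcongr

lemma eventually_chiTail_mul_chiLevel_le (hd : 1 ≤ d) (x : ℝ) {κ β : ℝ} (hκ : 0 < κ) (hβ0 : 0 < β)
    (hβ : β < κ ^ 2) :
    ∀ᶠ n : ℕ in atTop, chiTail d (κ * chiLevel d x n) ≤ (n : ℝ) ^ (-β) := by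
  -- Chosen so that `θ κ²` is the midpoint of `β` and `κ²`; since `u_n² ~ 2 log n`, the tail at `κ
  -- u_n` is roughly `n ^ (-κ²)`.
  set θ := (1 + β / κ ^ 2) / 2
  have hθ : θ < 1 := by
    have : β / κ ^ 2 < 1 := (div_lt_one (by positivity)).2 hβ
    simp only [θ]; linarith
  have hθκ : θ * κ ^ 2 = (κ ^ 2 + β) / 2 := by
    simp only [θ]; field_simp
  have h1 := ((tendsto_chiLevel_div hd x).pow 2).const_mul (θ * κ ^ 2)
  rw [one_pow, mul_one] at h1
  filter_upwards [((tendsto_chiLevel hd x).const_mul_atTop hκ).eventually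
    (eventually_chiTail_le hd hθ), h1.eventually_const_le (show β < θ * κ ^ 2 by linarith),
    eventually_ge_atTop 1, tendsto_chiA.eventually_gt_atTop 0] with n h2 h3 hn ha
  refine h2.trans ?_
  rw [Real.rpow_def_of_pos (by exact_mod_cast hn)]
  refine Real.exp_le_exp.2 ?_
  rw [div_pow, ← mul_div_assoc, le_div_iff₀ (by positivity), chiA_sq hn] at h3
  nlinarith

lemma tendsto_rpow_mul_chiTail_mul_chiLevel (hd : 1 ≤ d) (x : ℝ) {κ γ : ℝ} (hκ : 0 < κ)
    (hγ0 : 0 < γ) (hγ : γ < κ ^ 2) :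
    Tendsto (fun n : ℕ => (n : ℝ) ^ γ * chiTail d (κ * chiLevel d x n)) atTop (𝓝 0) := by
  have h1 : Tendsto (fun n : ℕ => (n : ℝ) ^ (-((κ ^ 2 - γ) / 2))) atTop (𝓝 0) :=
    (tendsto_rpow_neg_atTop (by linarith)).comp tendsto_natCast_atTop_atTop
  refine squeeze_zero' (Eventually.of_forall fun n =>
    mul_nonneg (by positivity) (chiTail_nonneg _ _)) ?_ h1
  filter_upwards [eventually_chiTail_mul_chiLevel_le hd x hκ (β := (κ ^ 2 + γ) / 2)
    (by positivity) (by linarith), eventually_ge_atTop 1] with n h2 hn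
  have hn0 : (0 : ℝ) < n := by exact_mod_cast hn
  calc _ ≤ (n : ℝ) ^ γ * (n : ℝ) ^ (-((κ ^ 2 + γ) / 2)) := by gcongr
    _ = _ := by rw [← Real.rpow_add hn0]; ring_nf

/-- The contribution of the pairs of terms with lag less than `n ^ α` is negligible. -/
lemma exists_tendsto_short_lag (hd : 1 ≤ d) (z : ℝ) {ρ : ℝ} (hρ0 : 0 ≤ ρ) (hρ : ρ < 1) :
    ∃ η α : ℝ, 0 < α ∧ Tendsto (fun n : ℕ => (n : ℝ) * (⌈(n : ℝ) ^ α⌉₊ *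
      (chiTail d (chiLevel d z n) * chiTail d (chiLevel d z n) +
        chiTail d ((1 + η) * chiLevel d z n) + 2 * (chiTail d (chiLevel d z n) *
          chiTail d ((1 - ρ * (1 + η)) * chiLevel d z n / 2))))) atTop (𝓝 0) := by
  -- This `η` makes `ρ (1 + η) < 1`, hence `κ > 0`. The bounds on `α` then give `1 + α < (1 + η)²`
  -- and `α < κ²`, so that `n ^ (1 + α) T((1 + η) u)` and `n T(u) · n ^ α T(κ u)` both vanish.
  set η := (1 - ρ) / 2
  set κ := (1 - ρ * (1 + η)) / 2
  set α := min (η / 2) (κ ^ 2 / 2)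
  have hη : 0 < η := by simp only [η]; linarith
  have hκ : 0 < κ := by simp only [κ, η]; nlinarith
  have hκ1 : κ ≤ 1 := by
    have : 0 ≤ ρ * (1 + η) := by positivity
    simp only [κ]; linarith
  have hα : 0 < α := by positivity
  have hα1 : α ≤ η / 2 := min_le_left _ _
  have hα2 : α ≤ κ ^ 2 / 2 := min_le_right _ _
  refine ⟨η, α, hα, ?_⟩
  have h1 := tendsto_rpow_mul_chiTail_mul_chiLevel hd z (κ := 1 + η) (γ := 1 + α) (by linarith)
    (by linarith) (by nlinarith)
  have h2 := tendsto_rpow_mul_chiTail_mul_chiLevel hd z hκ hα (by nlinarith)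
  have h3 := (h1.const_mul 2).add (((tendsto_nat_mul_chiTail hd z).mul h2).const_mul 6)
  simp only [mul_zero, add_zero] at h3
  refine squeeze_zero' (Eventually.of_forall fun n => ?_) ?_ h3
  · have := chiTail_nonneg d
    have := this (chiLevel d z n)
    have := chiTail_nonneg d ((1 + η) * chiLevel d z n)
    have := chiTail_nonneg d ((1 - ρ * (1 + η)) * chiLevel d z n / 2)
    positivity
  filter_upwards [eventually_ge_atTop 1, (tendsto_chiLevel hd z).eventually_ge_atTop 0]
    with n hn hu
  have hn1 : (1 : ℝ) ≤ n := by exact_mod_cast hn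
  have hN : (⌈(n : ℝ) ^ α⌉₊ : ℝ) ≤ 2 * (n : ℝ) ^ α := by
    have h4 := (Nat.ceil_lt_add_one (show 0 ≤ (n : ℝ) ^ α by positivity)).le
    have h5 := Real.one_le_rpow hn1 hα.le
    linarith
  have e : (1 - ρ * (1 + η)) * chiLevel d z n / 2 = κ * chiLevel d z n := by
    simp only [κ]; ring
  rw [e]
  set u := chiLevel d z n
  have g0 := chiTail_nonneg d u
  have g1 := chiTail_nonneg d ((1 + η) * u)
  have g2 := chiTail_nonneg d (κ * u)
  have g3 : chiTail d u ≤ chiTail d (κ * u) := chiTail_antitone d (by nlinarith)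
  calc (n : ℝ) * (⌈(n : ℝ) ^ α⌉₊ * (chiTail d u * chiTail d u + chiTail d ((1 + η) * u) +
        2 * (chiTail d u * chiTail d (κ * u))))
      ≤ (n : ℝ) * ((2 * (n : ℝ) ^ α) * (chiTail d u * chiTail d (κ * u) +
        chiTail d ((1 + η) * u) + 2 * (chiTail d u * chiTail d (κ * u)))) := by gcongr
    _ = _ := by rw [Real.rpow_add (by linarith), Real.rpow_one]; ring

/-- Tails at `2 u` are about `n ^ (-4)` and do not survive the factor `n²`. Only the thin shell
around the level remains, and its limit tends to zero with `δ`. -/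
lemma tendsto_long_lag (hd : 1 ≤ d) (z x δ : ℝ) :
    Tendsto (fun n : ℕ => (n : ℝ) * (n * (chiTail d (2 * chiLevel d z n) +
      chiTail d (chiLevel d z n) * chiTail d (2 * chiLevel d z n) + chiTail d (chiLevel d z n) *
        (chiTail d (chiLevel d (x - δ) n) - chiTail d (chiLevel d (x + δ) n))))) atTop
      (𝓝 (Real.exp (-z) * (Real.exp (-(x - δ)) - Real.exp (-(x + δ))))) := by
  have h1 := tendsto_rpow_mul_chiTail_mul_chiLevel hd z (κ := 2) (γ := 2) (by norm_num)
    (by norm_num) (by norm_num)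
  have h2 := tendsto_nat_mul_chiTail hd z
  have h3 := (tendsto_nat_mul_chiTail hd (x - δ)).sub (tendsto_nat_mul_chiTail hd (x + δ))
  have h4 : Tendsto (fun n : ℕ => (n : ℝ)⁻¹) atTop (𝓝 0) := tendsto_inv_atTop_nhds_zero_nat
  have h5 := (h1.add ((h1.mul h2).mul h4)).add (h2.mul h3)
  simp only [zero_mul, zero_add] at h5
  refine h5.congr' ?_
  filter_upwards [eventually_ge_atTop 1] with n hn
  have hn0 : (0 : ℝ) < n := by exact_mod_cast hn
  rw [Real.rpow_ofNat]
  field_simp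

/-- For lags between `n ^ α` and `n`, the perturbation of a level caused by the correlation is
smaller than the spacing of the levels. -/
lemma eventually_mul_chiLevel_le (hd : 1 ≤ d) (z : ℝ) {r : ℕ → ℝ}
    (hr : Tendsto (fun n : ℕ => r n * Real.log n) atTop (𝓝 0)) {α δ : ℝ} (hα : 0 < α)
    (hδ : 0 < δ) :
    ∀ᶠ n : ℕ in atTop, ∀ m ≥ ⌈(n : ℝ) ^ α⌉₊, 4 * |r m| * chiLevel d z n ≤ (chiA n)⁻¹ * δ := by
  have h1 := hr.abs
  rw [abs_zero] at h1
  obtain ⟨M, hM⟩ := eventually_atTop.1 (h1.eventually_le_const (show 0 < α * δ / 16 by positivity))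
  have h2 : Tendsto (fun n : ℕ => (n : ℝ) ^ α) atTop atTop :=
    (tendsto_rpow_atTop hα).comp tendsto_natCast_atTop_atTop
  filter_upwards [h2.eventually_ge_atTop M, tendsto_chiA.eventually_gt_atTop 0,
    eventually_ge_atTop 1, (tendsto_chiLevel_div hd z).eventually_le_const one_lt_two]
    with n hn ha hn1 hu m hm
  have hn0 : (0 : ℝ) < n := by exact_mod_cast hn1
  have hm1 : (n : ℝ) ^ α ≤ m := Nat.ceil_le.1 hm
  have h3 := hM m (by exact_mod_cast hn.trans hm1)
  have h4 : α * Real.log n ≤ Real.log m := by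
    rw [← Real.log_rpow hn0]
    exact Real.log_le_log (by positivity) hm1
  have h5 : 0 < Real.log n := by
    have := chiA_sq hn1
    nlinarith [sq_pos_of_pos ha]
  rw [abs_mul, abs_of_nonneg ((mul_pos hα h5).le.trans h4)] at h3
  have h6 : |r m| * (α * Real.log n) ≤ α * δ / 16 :=
    (mul_le_mul_of_nonneg_left h4 (abs_nonneg _)).trans h3
  have h7 : |r m| * Real.log n ≤ δ / 16 := by
    refine le_of_mul_le_mul_left ?_ hα
    linarith
  rw [div_le_iff₀ ha] at hu
  rw [← div_eq_inv_mul, le_div_iff₀ ha]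
  -- Since `u_n ≤ 2 a_n` and `a_n² = 2 log n`, the constant 16 matches the choice `α δ / 16` above.
  calc 4 * |r m| * chiLevel d z n * chiA n ≤ 4 * |r m| * (2 * chiA n) * chiA n := by gcongr
    _ = 16 * (|r m| * Real.log n) := by
      rw [show 4 * |r m| * (2 * chiA n) * chiA n = 8 * |r m| * chiA n ^ 2 by ring, chiA_sq hn1]
      ring
    _ ≤ δ := by linarith

end Levels

/-! ### Comparison with independent variables. -/

section Comparison

lemma sum_le_mul_add_mul_of_lag {J : Finset ℕ} {k n N : ℕ} (hJ : ∀ l ∈ J, l < k)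
    (hn : J.card ≤ n) {D : ℕ → ℝ} {a b : ℝ} (ha : 0 ≤ a) (hb : 0 ≤ b)
    (h1 : ∀ l ∈ J, k - l < N → D l ≤ a) (h2 : ∀ l ∈ J, N ≤ k - l → D l ≤ b) :
    ∑ l ∈ J, D l ≤ N * a + n * b := by
  rw [← Finset.sum_filter_add_sum_filter_not J fun l => k - l < N]
  have hcard : (J.filter fun l => k - l < N).card ≤ N := by
    rw [← Finset.card_range N]
    refine Finset.card_le_card_of_injOn (fun l => k - l) (fun l hl => ?_) fun l hl l' hl' e => ?_
    · simp only [Finset.coe_filter, Set.mem_ofPred_eq] at hl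
      simpa using hl.2
    · simp only [Finset.coe_filter, Set.mem_ofPred_eq] at hl hl' e
      have := hJ l hl.1
      have := hJ l' hl'.1
      omega
  refine add_le_add ?_ ?_
  · refine (Finset.sum_le_card_nsmul _ _ a fun l hl => ?_).trans ?_
    · exact h1 l (Finset.mem_filter.1 hl).1 (Finset.mem_filter.1 hl).2
    · rw [nsmul_eq_mul]; gcongr
  · refine (Finset.sum_le_card_nsmul _ _ b fun l hl => ?_).trans ?_
    · exact h2 l (Finset.mem_filter.1 hl).1 (not_lt.1 (Finset.mem_filter.1 hl).2)
    · rw [nsmul_eq_mul]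
      have := (Finset.card_filter_le J fun l => ¬ k - l < N).trans hn
      gcongr

variable {Ω : Type*} [MeasurableSpace Ω] {P : Measure Ω} [IsProbabilityMeasure P]
  {d : ℕ} {Z : Fin d → ℕ → Ω → ℝ} {r : ℕ → ℝ}

/-- Under Berman's condition, the terms of the chi sequence behave like independent variables with
respect to the levels `a_n⁻¹ x + b_n`, uniformly in the set of indices considered. -/
theorem eventually_abs_measureReal_forall_chiSeq_le_sub_prod_le (hd : 1 ≤ d)
    (hZm : ∀ j k, Measurable (Z j k))
    (hZ : ∀ j, IsStdGaussianSeq (Z j) r P) (hind : iIndepFun (fun j ω k => Z j k ω) P)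
    (hr : Tendsto (fun n : ℕ => r n * Real.log n) atTop (𝓝 0)) (x y : ℝ) {ε : ℝ} (hε : 0 < ε) :
    ∀ᶠ n : ℕ in atTop, ∀ I ⊆ Finset.range n, ∀ t : ℕ → ℝ,
      (∀ k, t k = chiLevel d x n ∨ t k = chiLevel d y n) →
      |P.real {ω | ∀ k ∈ I, chiSeq Z k ω ≤ t k} - ∏ k ∈ I, (1 - chiTail d (t k))| ≤ ε := by
  have hr0 : Tendsto r atTop (𝓝 0) := by
    have h1 : Tendsto (fun n : ℕ => (Real.log n)⁻¹) atTop (𝓝 0) :=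
      (Real.tendsto_log_atTop.comp tendsto_natCast_atTop_atTop).inv_tendsto_atTop
    have h2 := hr.mul h1
    rw [mul_zero] at h2
    refine h2.congr' ?_
    filter_upwards [eventually_gt_atTop 1] with n hn
    have := Real.log_pos (show (1 : ℝ) < n by exact_mod_cast hn)
    field_simp
  obtain ⟨ρ, hρ1, hρ⟩ := (hZ ⟨0, hd⟩).exists_abs_le hr0
  have hρ0 : 0 ≤ ρ := (abs_nonneg _).trans (hρ 1 le_rfl)
  set z := min x y
  obtain ⟨η, α, hα, hshort⟩ := exists_tendsto_short_lag hd z hρ0 hρ1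
  have hcont (w : ℝ) : Tendsto
      (fun δ : ℝ => Real.exp (-z) * (Real.exp (-(w - δ)) - Real.exp (-(w + δ)))) (𝓝[>] 0)
      (𝓝 0) := by
    have : Continuous
      (fun δ : ℝ => Real.exp (-z) * (Real.exp (-(w - δ)) - Real.exp (-(w + δ)))) := by fun_prop
    simpa using (this.tendsto 0).mono_left nhdsWithin_le_nhds
  -- The width `δ` is fixed before `n`. The short lags and the shells at the two levels then cost `ε
  -- / 4` each.
  obtain ⟨δ, hδx, hδy, hδ⟩ := (((hcont x).eventually_lt_const (show 0 < ε / 4 by positivity)).and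
    (((hcont y).eventually_lt_const (show 0 < ε / 4 by positivity)).and self_mem_nhdsWithin)).exists
  have hδ : 0 < δ := hδ
  filter_upwards [hshort.eventually_le_const (show 0 < ε / 4 by positivity),
    (tendsto_long_lag hd z x δ).eventually_le_const hδx,
    (tendsto_long_lag hd z y δ).eventually_le_const hδy,
    eventually_mul_chiLevel_le hd z hr hα hδ, tendsto_chiA.eventually_gt_atTop 0]
    with n hs hlx hly hlag ha I hI t ht
  set u := chiLevel d z n
  have hut (k : ℕ) : u ≤ t k := by
    rcases ht k with h | h <;> rw [h]
    · exact chiLevel_mono d n (min_le_left _ _)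
    · exact chiLevel_mono d n (min_le_right _ _)
  set N := ⌈(n : ℝ) ^ α⌉₊
  set e1 := chiTail d u * chiTail d u + chiTail d ((1 + η) * u) +
    2 * (chiTail d u * chiTail d ((1 - ρ * (1 + η)) * u / 2))
  set e2 : ℝ → ℝ := fun w => chiTail d (2 * u) + chiTail d u * chiTail d (2 * u) + chiTail d u *
        (chiTail d (chiLevel d (w - δ) n) - chiTail d (chiLevel d (w + δ) n))
  have he1 : 0 ≤ e1 := by
    have := chiTail_nonneg d u
    have := chiTail_nonneg d ((1 + η) * u)
    have := chiTail_nonneg d ((1 - ρ * (1 + η)) * u / 2)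
    positivity
  have he2 (w : ℝ) : 0 ≤ e2 w := by
    have := chiTail_nonneg d u
    have := chiTail_nonneg d (2 * u)
    have := sub_nonneg.2 (chiTail_antitone d
      (chiLevel_mono d n (show w - δ ≤ w + δ by linarith)))
    positivity
  have htail := measureReal_lt_norm_vecSeq hZm hZ hind
  have hUm := measurable_vecSeq hZm
  have hle (k : ℕ) : P.real {ω | chiSeq Z k ω ≤ t k} = 1 - chiTail d (t k) := by
    have hm : MeasurableSet {ω | t k < ‖vecSeq Z k ω‖} :=
      measurableSet_lt measurable_const (hUm k).norm
    rw [← htail k, ← probReal_compl_eq_one_sub hm]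
    congr 1 with ω
    simp [chiSeq_eq_norm]
  have key := abs_measureReal_forall_sub_prod_le (P := P) (A := fun k => {ω | chiSeq Z k ω ≤ t k})
    (δ := N * e1 + n * (e2 x + e2 y)) I ?_
  · simp only [hle, Set.mem_ofPred_eq] at key
    refine key.trans ?_
    have hcard : (I.card : ℝ) ≤ n := by
      exact_mod_cast (Finset.card_le_card hI).trans (Finset.card_range n).le
    have := he2 x
    have := he2 y
    calc (I.card : ℝ) * (N * e1 + n * (e2 x + e2 y)) ≤ n * (N * e1 + n * (e2 x + e2 y)) := by
          gcongr
      _ = n * (N * e1) + (n * (n * e2 x) + n * (n * e2 y)) := by ring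
      _ ≤ ε := by linarith
  · intro k _ J hJI hJ
    simp only [chiSeq_eq_norm, Set.mem_ofPred_eq]
    refine (abs_measureReal_inter_sub_le_sum (hUm k) hUm (indepFun_vecSeq_sub hZm hZ hind k)
      J t (t k)).trans ?_
    refine sum_le_mul_add_mul_of_lag hJ
      ((Finset.card_le_card (hJI.trans hI)).trans (Finset.card_range n).le) he1
      (add_nonneg (he2 x) (he2 y)) (fun l hl _ => ?_) fun l hl hN => ?_
    · refine measureReal_exceedance_change_le_of_abs_le (htail k) (htail l) (hut k) (hut l)
        (hρ _ ?_) hρ1.le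
      rw [Nat.dist_eq_sub_of_le_right (hJ l hl).le]
      have := hJ l hl
      omega
    · have h1 := hlag _ hN
      rw [← Nat.dist_eq_sub_of_le_right (hJ l hl).le] at h1
      refine (measureReal_exceedance_change_le_of_mul_le (hUm l) (htail k) (htail l) (hut k)
        h1 (by positivity)).trans ?_
      have hsub (w : ℝ) : chiLevel d w n - (chiA n)⁻¹ * δ = chiLevel d (w - δ) n := by
        simp only [chiLevel]; ring
      have hadd (w : ℝ) : chiLevel d w n + (chiA n)⁻¹ * δ = chiLevel d (w + δ) n := by
        simp only [chiLevel]; ring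
      rcases ht l with h | h <;> rw [h, hsub, hadd]
      · exact le_add_of_nonneg_right (he2 y)
      · exact le_add_of_nonneg_left (he2 x)

end Comparison

/-! ### Passage to the random proportion and conditioning on replacements. -/

lemma tendsto_integral_exp_of_tendstoInMeasure {Ω : Type*} [MeasurableSpace Ω] {P : Measure Ω}
    [IsProbabilityMeasure P] {f : ℕ → Ω → ℝ} {g : Ω → ℝ} (hf : ∀ n, AEMeasurable (f n) P)
    (hf1 : ∀ n, ∀ᵐ ω ∂P, f n ω ≤ 1) (h : TendstoInMeasure P f atTop g) {c : ℕ → ℝ} {c₀ : ℝ}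
    (hc : Tendsto c atTop (𝓝 c₀)) (hc0 : ∀ n, 0 ≤ c n) :
    Tendsto (fun n => ∫ ω, Real.exp (-(1 - f n ω) * c n) ∂P) atTop
      (𝓝 (∫ ω, Real.exp (-(1 - g ω) * c₀) ∂P)) := by
  -- Convergence in measure gives almost sure convergence along a further subsequence, and the
  -- integrands are bounded by 1.
  refine tendsto_of_subseq_tendsto fun ns hns => ?_
  obtain ⟨ms, hms, hae⟩ := (h.comp hns).exists_seq_tendsto_ae'
  refine ⟨ms, tendsto_integral_of_dominated_convergence (fun _ => 1) (fun n => ?_)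
    (integrable_const _) (fun n => ?_) ?_⟩
  · have := hf (ns (ms n))
    exact (Real.measurable_exp.comp_aemeasurable
      (((this.const_sub 1).neg).mul_const _)).aestronglyMeasurable
  · filter_upwards [hf1 (ns (ms n))] with ω hω
    rw [Real.norm_eq_abs, Real.abs_exp, Real.exp_le_one_iff]
    nlinarith [hc0 (ns (ms n))]
  · filter_upwards [hae] with ω hω
    have h1 := ((hω.const_sub 1).neg.mul (hc.comp (hns.comp hms))).rexp
    exact h1

section Replacing

variable {Ω : Type*} [MeasurableSpace Ω] {P : Measure Ω} [IsProbabilityMeasure P]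

/-- The set of indices `k < n` with `ε k = 1`. -/
noncomputable def observed {Ω : Type*} (ε : ℕ → Ω → ℝ) (n : ℕ) (ω : Ω) : Finset ℕ :=
  (Finset.range n).filter fun k => ε k ω = 1

omit [MeasurableSpace Ω] in
lemma observed_eq_iff {ε : ℕ → Ω → ℝ} {n : ℕ} {ω : Ω} {S : Finset ℕ} (hS : S ⊆ Finset.range n) :
    observed ε n ω = S ↔ ∀ k ∈ Finset.range n, (ε k ω = 1 ↔ k ∈ S) := by
  simp only [observed, Finset.ext_iff, Finset.mem_filter]
  refine ⟨fun h k hk => ?_, fun h k => ⟨fun hk => (h k hk.1).1 hk.2, fun hk => ?_⟩⟩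
  · rw [← h k]; simp [hk]
  · exact ⟨hS hk, (h k (hS hk)).2 hk⟩

lemma measurableSet_pattern (n : ℕ) (S : Finset ℕ) :
    MeasurableSet {f : ℕ → ℝ | ∀ k ∈ Finset.range n, (f k = 1 ↔ k ∈ S)} := by
  have e : {f : ℕ → ℝ | ∀ k ∈ Finset.range n, (f k = 1 ↔ k ∈ S)} =
      ⋂ k ∈ Finset.range n, {f | f k = 1 ↔ k ∈ S} := by ext; simp
  rw [e]
  refine (Finset.range n).measurableSet_biInter fun k _ => ?_
  have h1 : MeasurableSet {f : ℕ → ℝ | f k = 1} :=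
    measurable_pi_apply k (measurableSet_singleton 1)
  by_cases hk : k ∈ S
  · simpa [hk] using h1
  · simp only [hk, iff_false]
    exact h1.compl

lemma setOf_observed_eq {Ω : Type*} {ε : ℕ → Ω → ℝ} {n : ℕ} {S : Finset ℕ}
    (hS : S ⊆ Finset.range n) :
    {ω | observed ε n ω = S} =
      (fun ω k => ε k ω) ⁻¹' {f : ℕ → ℝ | ∀ k ∈ Finset.range n, (f k = 1 ↔ k ∈ S)} := by
  ext ω
  exact observed_eq_iff hS

lemma measurableSet_observed_eq {ε : ℕ → Ω → ℝ} (hε : ∀ k, Measurable (ε k)) {n : ℕ}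
    {S : Finset ℕ} (hS : S ⊆ Finset.range n) : MeasurableSet {ω | observed ε n ω = S} := by
  rw [setOf_observed_eq hS]
  exact (measurable_pi_lambda _ hε) (measurableSet_pattern n S)

lemma measureReal_eq_sum_observed {ε : ℕ → Ω → ℝ} (hε : ∀ k, Measurable (ε k)) (n : ℕ)
    (A : Set Ω) (hA : MeasurableSet A) :
    P.real A = ∑ S ∈ (Finset.range n).powerset, P.real ({ω | observed ε n ω = S} ∩ A) := by
  rw [← measureReal_biUnion_finset]
  · congr 1
    ext ω
    simp [observed]
  · intro S _ T _ hST
    refine Set.disjoint_left.2 fun ω h1 h2 => hST ?_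
    exact h1.1.symm.trans h2.1
  · intro S hS
    exact (measurableSet_observed_eq hε (Finset.mem_powerset.1 hS)).inter hA

lemma integral_observed {ε : ℕ → Ω → ℝ} (hε : ∀ k, Measurable (ε k)) (n : ℕ)
    (φ : Finset ℕ → ℝ) :
    ∫ ω, φ (observed ε n ω) ∂P =
      ∑ S ∈ (Finset.range n).powerset, P.real {ω | observed ε n ω = S} * φ S := by
  have h1 (ω : Ω) : φ (observed ε n ω) = ∑ S ∈ (Finset.range n).powerset,
      {ω | observed ε n ω = S}.indicator (fun _ => φ S) ω := by
    rw [Finset.sum_eq_single (observed ε n ω)]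
    · simp
    · intro S _ hS
      exact Set.indicator_of_notMem (fun h => hS h.symm) _
    · intro h
      simp [observed] at h
  have hm {S : Finset ℕ} (hS : S ∈ (Finset.range n).powerset) :=
    measurableSet_observed_eq hε (Finset.mem_powerset.1 hS)
  simp_rw [h1]
  rw [integral_finsetSum _ fun S hS => (integrable_const _).indicator (hm hS)]
  refine Finset.sum_congr rfl fun S hS => ?_
  rw [integral_indicator (hm hS)]
  simp

/-- Conditioning on the pattern of replacements. -/
lemma measureReal_replacingSeq_le {X X' ε : ℕ → Ω → ℝ} (hX : ∀ k, Measurable (X k))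
    (hX' : ∀ k, Measurable (X' k)) (hε : ∀ k, Measurable (ε k))
    (hε01 : ∀ k, ∀ᵐ ω ∂P, ε k ω = 0 ∨ ε k ω = 1)
    (hindep : IndepFun (fun ω k => X k ω) (fun ω k => X' k ω) P)
    (hεindep : IndepFun (fun ω k => ε k ω) (fun ω k => (X k ω, X' k ω)) P) (n : ℕ) (a b : ℝ) :
    P.real {ω | ∀ k ∈ Finset.range n, replacingSeq X X' ε k ω ≤ a ∧ X k ω ≤ b} =
      ∑ S ∈ (Finset.range n).powerset, P.real {ω | observed ε n ω = S} *
        (P.real {ω | ∀ k ∈ Finset.range n, X k ω ≤ if k ∈ S then min a b else b} *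
          P.real {ω | ∀ k ∈ Finset.range n \ S, X' k ω ≤ a}) := by
  have hR (k : ℕ) : Measurable (replacingSeq X X' ε k) :=
    ((hε k).mul (hX k)).add (((hε k).const_sub 1).mul (hX' k))
  have hA : MeasurableSet
      {ω | ∀ k ∈ Finset.range n, replacingSeq X X' ε k ω ≤ a ∧ X k ω ≤ b} := by
    have e : {ω | ∀ k ∈ Finset.range n, replacingSeq X X' ε k ω ≤ a ∧ X k ω ≤ b} =
        ⋂ k ∈ Finset.range n, {ω | replacingSeq X X' ε k ω ≤ a} ∩ {ω | X k ω ≤ b} := by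
      ext; simp
    rw [e]
    exact (Finset.range n).measurableSet_biInter fun k _ =>
      (measurableSet_le (hR k) measurable_const).inter (measurableSet_le (hX k) measurable_const)
  have hbox (I : Finset ℕ) (t : ℕ → ℝ) : MeasurableSet {f : ℕ → ℝ | ∀ k ∈ I, f k ≤ t k} := by
    have e : {f : ℕ → ℝ | ∀ k ∈ I, f k ≤ t k} = ⋂ k ∈ I, {f | f k ≤ t k} := by ext; simp
    rw [e]
    exact I.measurableSet_biInter fun k _ =>
      measurableSet_le (measurable_pi_apply k) measurable_const
  rw [measureReal_eq_sum_observed hε n _ hA]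
  refine Finset.sum_congr rfl fun S hS => ?_
  have hS := Finset.mem_powerset.1 hS
  set B₁ : Set (ℕ → ℝ) := {f | ∀ k ∈ Finset.range n, f k ≤ if k ∈ S then min a b else b}
  set B₂ : Set (ℕ → ℝ) := {f | ∀ k ∈ Finset.range n \ S, f k ≤ a}
  have hB₁ : MeasurableSet B₁ := hbox _ _
  have hB₂ : MeasurableSet B₂ := hbox _ _
  -- On this event an index in `S` constrains only `X k`, by both levels at once; any other index
  -- constrains `X k` by `b` and `X' k` by `a`. The equality is only almost sure because `ε` is
  -- `{0,1}`-valued only almost surely.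
  have h1 : ({ω | observed ε n ω = S} ∩
      {ω | ∀ k ∈ Finset.range n, replacingSeq X X' ε k ω ≤ a ∧ X k ω ≤ b} : Set Ω) =ᵐ[P]
      ({ω | observed ε n ω = S} ∩ ((fun ω k => X k ω) ⁻¹' B₁ ∩ (fun ω k => X' k ω) ⁻¹' B₂) :
        Set Ω) := by
    filter_upwards [ae_all_iff.2 hε01] with ω hω
    refine propext (and_congr_right fun h2 => ?_)
    have h2 := (observed_eq_iff hS).1 h2
    simp only [B₁, B₂, Set.mem_inter_iff, Set.mem_preimage, Set.mem_ofPred_eq]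
    constructor
    · intro h
      refine ⟨fun k hk => ?_, fun k hk => ?_⟩
      · obtain ⟨h3, h4⟩ := h k hk
        split_ifs with hkS
        · have := (h2 k hk).2 hkS
          simp only [replacingSeq, this] at h3
          exact le_min (by linarith) h4
        · exact h4
      · obtain ⟨hk, hkS⟩ := Finset.mem_sdiff.1 hk
        obtain ⟨h3, h4⟩ := h k hk
        have := (hω k).resolve_right fun h5 => hkS ((h2 k hk).1 h5)
        simp only [replacingSeq, this] at h3
        linarith
    · rintro ⟨h, h'⟩ k hk
      have h3 := h k hk
      by_cases hkS : k ∈ S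
      · rw [if_pos hkS, le_min_iff] at h3
        have := (h2 k hk).2 hkS
        simp only [replacingSeq, this]
        exact ⟨by linarith, h3.2⟩
      · rw [if_neg hkS] at h3
        have h4 := h' k (Finset.mem_sdiff.2 ⟨hk, hkS⟩)
        have := (hω k).resolve_right fun h5 => hkS ((h2 k hk).1 h5)
        simp only [replacingSeq, this]
        exact ⟨by linarith, h3⟩
  have h2 : P ({ω | observed ε n ω = S} ∩
      ((fun ω k => X k ω) ⁻¹' B₁ ∩ (fun ω k => X' k ω) ⁻¹' B₂)) =
      P {ω | observed ε n ω = S} *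
        P ((fun ω k => X k ω) ⁻¹' B₁ ∩ (fun ω k => X' k ω) ⁻¹' B₂) := by
    have hfst : Measurable fun (f : ℕ → ℝ × ℝ) (k : ℕ) => (f k).1 :=
      measurable_pi_lambda _ fun k => (measurable_pi_apply k).fst
    have hsnd : Measurable fun (f : ℕ → ℝ × ℝ) (k : ℕ) => (f k).2 :=
      measurable_pi_lambda _ fun k => (measurable_pi_apply k).snd
    rw [setOf_observed_eq hS]
    exact hεindep.measure_inter_preimage_eq_mul _ _ (measurableSet_pattern n S)
      ((hfst hB₁).inter (hsnd hB₂))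
  rw [measureReal_congr h1, measureReal_def, h2,
    hindep.measure_inter_preimage_eq_mul _ _ hB₁ hB₂, ENNReal.toReal_mul, ENNReal.toReal_mul]
  rfl

/-- Since `G a * G b = G (min a b) * G (max a b)`, every index gives one factor at the minimum, and
those outside `S` a further one at the maximum. Only the cardinality of `S` matters. -/
lemma prod_ite_mul_prod_sdiff {G : ℝ → ℝ} {n : ℕ} {S : Finset ℕ} (hS : S ⊆ Finset.range n)
    (a b : ℝ) :
    (∏ k ∈ Finset.range n, G (if k ∈ S then min a b else b)) *
      ∏ _k ∈ Finset.range n \ S, G a = G (min a b) ^ n * G (max a b) ^ (n - S.card) := by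
  have hab : G b * G a = G (min a b) * G (max a b) := by
    rcases le_total a b with h | h
    · rw [min_eq_left h, max_eq_right h, mul_comm]
    · rw [min_eq_right h, max_eq_left h]
  have h1 : ∏ k ∈ S, G (if k ∈ S then min a b else b) = G (min a b) ^ S.card := by
    rw [← Finset.prod_const]
    exact Finset.prod_congr rfl fun k hk => by rw [if_pos hk]
  have h2 : ∏ k ∈ Finset.range n \ S, G (if k ∈ S then min a b else b) =
      ∏ _k ∈ Finset.range n \ S, G b :=
    Finset.prod_congr rfl fun k hk => by rw [if_neg (Finset.mem_sdiff.1 hk).2]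
  have hcard := Finset.card_le_card hS
  rw [Finset.card_range] at hcard
  rw [← Finset.prod_sdiff hS, h1, h2, mul_right_comm, ← Finset.prod_mul_distrib, hab,
    Finset.prod_const, Finset.card_sdiff_of_subset hS, Finset.card_range, mul_pow]
  rw [mul_right_comm, ← pow_add, Nat.sub_add_cancel hcard]

end Replacing

section SeqMax

lemma seqMax_le_iff {Ω : Type*} {X : ℕ → Ω → ℝ} {n : ℕ} (hn : 1 ≤ n) {ω : Ω} {a : ℝ} :
    seqMax X n ω ≤ a ↔ ∀ k ∈ Finset.range n, X k ω ≤ a := by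
  -- For `n = 0` the real supremum takes the default value 0 and the equivalence fails.
  have : Nonempty (Fin n) := ⟨⟨0, hn⟩⟩
  rw [seqMax, ciSup_le_iff (Set.finite_range _).bddAbove]
  exact ⟨fun h k hk => h ⟨k, Finset.mem_range.1 hk⟩, fun h k => h k (Finset.mem_range.2 k.2)⟩

end SeqMax

/-! ### The limit theorem. -/

lemma tendsto_nat_mul_neg_log_one_sub {g : ℕ → ℝ} {c : ℝ}
    (h : Tendsto (fun n : ℕ => n * g n) atTop (𝓝 c)) :
    Tendsto (fun n : ℕ => n * -Real.log (1 - g n)) atTop (𝓝 c) := by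
  have h1 : Tendsto (fun n : ℕ => n * -g n) atTop (𝓝 (-c)) := by simpa using h.neg
  simpa [sub_eq_add_neg] using (Real.tendsto_nat_mul_log_one_add_of_tendsto h1).neg

theorem theorem2p3 {Ω₀ Ω : Type*} [MeasurableSpace Ω₀] [MeasurableSpace Ω]
    (P₀ : Measure Ω₀) [IsProbabilityMeasure P₀] (P : Measure Ω) [IsProbabilityMeasure P]
    -- the Gaussian sequence and its covariance function
    (Y : ℕ → Ω₀ → ℝ) (r : ℕ → ℝ) (hY : IsStdGaussianSeq Y r P₀)
    (hr : Tendsto (fun n : ℕ => r n * Real.log n) atTop (𝓝 0))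
    -- its `d` mutually independent copies
    (d : ℕ) (hd : 1 ≤ d) (Z : Fin d → ℕ → Ω → ℝ) (hZm : ∀ j k, Measurable (Z j k))
    (hZcopy : ∀ j, IsCopy (Z j) P Y P₀)
    (hZindep : iIndepFun (fun j ω k => Z j k ω) P)
    -- an independent copy of the chi sequence
    (χ' : ℕ → Ω → ℝ) (hχ'm : ∀ k, Measurable (χ' k))
    (hχ'copy : IsCopy χ' P (chiSeq Z) P)
    (hχ'indep : IndepFun (fun ω k => chiSeq Z k ω) (fun ω k => χ' k ω) P)
    -- the Bernoulli variables, independent of the chi sequence and its copy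
    (ε : ℕ → Ω → ℝ) (hεm : ∀ k, Measurable (ε k))
    (hε01 : ∀ k, ∀ᵐ ω ∂P, ε k ω = 0 ∨ ε k ω = 1)
    (hεindep : IndepFun (fun ω k => ε k ω) (fun ω k => (chiSeq Z k ω, χ' k ω)) P)
    -- the limiting proportion of observed terms
    (lam : Ω → ℝ) (hlamm : Measurable lam) (hlam01 : ∀ᵐ ω ∂P, lam ω ∈ Set.Icc (0 : ℝ) 1)
    (hlam : TendstoInMeasure P
      (fun (n : ℕ) ω => (∑ k ∈ Finset.range n, ε k ω) / n) atTop lam)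
    (x y : ℝ) :
    Tendsto
      (fun n : ℕ => P.real {ω |
        seqMax (replacingSeq (chiSeq Z) χ' ε) n ω ≤ (chiA n)⁻¹ * x + chiB d n ∧
        seqMax (chiSeq Z) n ω ≤ (chiA n)⁻¹ * y + chiB d n})
      atTop
      (𝓝 (Real.exp (-Real.exp (-(min x y))) *
        ∫ ω, Real.exp (-(1 - lam ω) * Real.exp (-(max x y))) ∂P)) := by
  have hZ : ∀ j, IsStdGaussianSeq (Z j) r P := fun j => hY.of_isCopy (hZcopy j)
  have hχm (k : ℕ) : Measurable (chiSeq Z k) := by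
    rw [show chiSeq Z k = fun ω => ‖vecSeq Z k ω‖ from funext fun ω => chiSeq_eq_norm k ω]
    exact (measurable_vecSeq hZm k).norm
  have hmin (n : ℕ) : min (chiLevel d x n) (chiLevel d y n) = chiLevel d (min x y) n :=
    (Monotone.map_min fun _ _ h => chiLevel_mono d n h).symm
  have hmax (n : ℕ) : max (chiLevel d x n) (chiLevel d y n) = chiLevel d (max x y) n :=
    (Monotone.map_max fun _ _ h => chiLevel_mono d n h).symm
  set F : ℕ → Finset ℕ → ℝ := fun n S =>
    (1 - chiTail d (chiLevel d (min x y) n)) ^ n *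
      (1 - chiTail d (chiLevel d (max x y) n)) ^ (n - S.card)
  set c : ℝ → ℕ → ℝ := fun z n => n * -Real.log (1 - chiTail d (chiLevel d z n))
  have hc (z : ℝ) : Tendsto (c z) atTop (𝓝 (Real.exp (-z))) :=
    tendsto_nat_mul_neg_log_one_sub (tendsto_nat_mul_chiTail hd z)
  have hc0 (z : ℝ) (n : ℕ) : 0 ≤ c z n := by
    refine mul_nonneg (Nat.cast_nonneg n) (neg_nonneg.2 (Real.log_nonpos ?_ ?_))
    · linarith [chiTail_le_one d (chiLevel d z n)]
    · linarith [chiTail_nonneg d (chiLevel d z n)]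
  have hsum (n : ℕ) : ∀ᵐ ω ∂P, ∑ k ∈ Finset.range n, ε k ω = (observed ε n ω).card := by
    filter_upwards [ae_all_iff.2 hε01] with ω hω
    rw [observed, Finset.card_filter, Nat.cast_sum]
    refine Finset.sum_congr rfl fun k _ => ?_
    rcases hω k with h | h <;> simp [h]
  have hcard (n : ℕ) (ω : Ω) : (observed ε n ω).card ≤ n :=
    (Finset.card_filter_le _ _).trans (Finset.card_range n).le
  -- the limit of the conditionally independent approximation
  have hlim : Tendsto (fun n => ∫ ω, F n (observed ε n ω) ∂P) atTop
      (𝓝 (Real.exp (-Real.exp (-(min x y))) *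
        ∫ ω, Real.exp (-(1 - lam ω) * Real.exp (-(max x y))) ∂P)) := by
    have h1 := tendsto_integral_exp_of_tendstoInMeasure
      (fun n => (((Finset.range n).measurable_fun_sum fun k _ =>
        hεm k).div_const (n : ℝ)).aemeasurable)
      (fun n => by
        filter_upwards [hsum n] with ω hω
        rw [hω]
        exact div_le_one_of_le₀ (by exact_mod_cast hcard n ω) (Nat.cast_nonneg n))
      hlam (hc (max x y)) (hc0 _)
    refine ((hc (min x y)).neg.rexp.mul h1).congr' ?_
    -- Needed to write powers of `1 - T` as exponentials of logarithms.
    have htail (z : ℝ) : ∀ᶠ n in atTop, chiTail d (chiLevel d z n) < 1 := by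
      filter_upwards [(tendsto_chiLevel hd z).eventually (eventually_chiTail_le hd
        (show (1 / 2 : ℝ) < 1 by norm_num)), (tendsto_chiLevel hd z).eventually_gt_atTop 0]
        with n h h0
      exact h.trans_lt (Real.exp_lt_one_iff.2 (by have := sq_pos_of_pos h0; linarith))
    filter_upwards [htail (min x y), htail (max x y), eventually_ge_atTop 1] with n h2 h3 hn
    have hn0 : (n : ℝ) ≠ 0 := by positivity
    rw [← integral_const_mul]
    refine integral_congr_ae ?_
    filter_upwards [hsum n] with ω hω
    have hpow (z : ℝ) (hz : chiTail d (chiLevel d z n) < 1) (m : ℕ) :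
        (1 - chiTail d (chiLevel d z n)) ^ m =
          Real.exp (m * Real.log (1 - chiTail d (chiLevel d z n))) := by
      rw [Real.exp_nat_mul, Real.exp_log (sub_pos.2 hz)]
    simp only [F, c]
    rw [hpow _ h2, hpow _ h3, hω, Nat.cast_sub (hcard n ω)]
    congr 2
    · ring
    · field_simp
  rw [Metric.tendsto_atTop] at hlim ⊢
  intro e he
  obtain ⟨N₁, hN₁⟩ := hlim (e / 2) (by positivity)
  obtain ⟨N₂, hN₂⟩ := eventually_atTop.1
    (eventually_abs_measureReal_forall_chiSeq_le_sub_prod_le hd hZm hZ hZindep hr x y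
      (show 0 < e / 6 by positivity))
  refine ⟨max N₁ (max N₂ 1), fun n hn => ?_⟩
  obtain ⟨hn1, hn2, hn3⟩ : N₁ ≤ n ∧ N₂ ≤ n ∧ 1 ≤ n := by simpa using hn
  have hset : {ω | seqMax (replacingSeq (chiSeq Z) χ' ε) n ω ≤ (chiA n)⁻¹ * x + chiB d n ∧
        seqMax (chiSeq Z) n ω ≤ (chiA n)⁻¹ * y + chiB d n} =
      {ω | ∀ k ∈ Finset.range n, replacingSeq (chiSeq Z) χ' ε k ω ≤ chiLevel d x n ∧
        chiSeq Z k ω ≤ chiLevel d y n} := by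
    ext ω
    simp only [Set.mem_ofPred_eq, seqMax_le_iff hn3, chiLevel, ← forall₂_and]
  have happrox : |P.real {ω | ∀ k ∈ Finset.range n,
      replacingSeq (chiSeq Z) χ' ε k ω ≤ chiLevel d x n ∧ chiSeq Z k ω ≤ chiLevel d y n} -
      ∫ ω, F n (observed ε n ω) ∂P| ≤ e / 3 := by
    rw [measureReal_replacingSeq_le hχm hχ'm hεm hε01 hχ'indep hεindep, integral_observed hεm,
      ← Finset.sum_sub_distrib]
    refine (Finset.abs_sum_le_sum_abs _ _).trans ?_
    have htotal : ∑ S ∈ (Finset.range n).powerset, P.real {ω | observed ε n ω = S} = 1 := by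
      simpa using (measureReal_eq_sum_observed (P := P) hεm n _ MeasurableSet.univ).symm
    -- The pattern probabilities sum to 1, so a bound uniform in `S` suffices.
    rw [← one_mul (e / 3), ← htotal, Finset.sum_mul]
    refine Finset.sum_le_sum fun S hS => ?_
    have hS := Finset.mem_powerset.1 hS
    rw [← mul_sub, abs_mul, abs_of_nonneg measureReal_nonneg]
    refine mul_le_mul_of_nonneg_left ?_ measureReal_nonneg
    have hcopy : P.real {ω | ∀ k ∈ Finset.range n \ S, χ' k ω ≤ chiLevel d x n} =
        P.real {ω | ∀ k ∈ Finset.range n \ S, chiSeq Z k ω ≤ chiLevel d x n} := by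
      have hm : MeasurableSet {f : ℕ → ℝ | ∀ k ∈ Finset.range n \ S, f k ≤ chiLevel d x n} := by
        simp only [Set.ofPred_forall]
        exact (Finset.range n \ S).measurableSet_biInter fun k _ =>
          measurableSet_le (measurable_pi_apply k) measurable_const
      exact congrArg ENNReal.toReal (hχ'copy.measure_mem_eq hm)
    -- The threshold at each index is one of the two levels, since a minimum is one of its
    -- arguments. This and `h2` cost `e / 6` each.
    have h1 := hN₂ n hn2 _ subset_rfl
      (fun k => if k ∈ S then min (chiLevel d x n) (chiLevel d y n) else chiLevel d y n)
      fun k => by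
        split_ifs
        · exact min_choice _ _
        · exact Or.inr rfl
    have h2 := hN₂ n hn2 (Finset.range n \ S) Finset.sdiff_subset (fun _ => chiLevel d x n)
      fun k => Or.inl rfl
    have h3 := prod_ite_mul_prod_sdiff (G := fun u => 1 - chiTail d u) hS (chiLevel d x n)
      (chiLevel d y n)
    rw [hmin, hmax] at h3
    rw [hcopy, show F n S = _ from h3.symm]
    rw [hmin] at h1 ⊢
    set p₁ := P.real {ω | ∀ k ∈ Finset.range n,
      chiSeq Z k ω ≤ if k ∈ S then chiLevel d (min x y) n else chiLevel d y n}
    set p₂ := P.real {ω | ∀ k ∈ Finset.range n \ S, chiSeq Z k ω ≤ chiLevel d x n}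
    set q₁ := ∏ k ∈ Finset.range n,
      (1 - chiTail d (if k ∈ S then chiLevel d (min x y) n else chiLevel d y n))
    set q₂ := ∏ _k ∈ Finset.range n \ S, (1 - chiTail d (chiLevel d x n))
    have hp₁ : |p₁| ≤ 1 := by
      rw [abs_of_nonneg measureReal_nonneg]
      exact measureReal_le_one
    have hq₂ : |q₂| ≤ 1 := by
      have h4 := chiTail_nonneg d (chiLevel d x n)
      have h5 := chiTail_le_one d (chiLevel d x n)
      rw [abs_of_nonneg (Finset.prod_nonneg fun _ _ => by linarith)]
      exact Finset.prod_le_one (fun _ _ => by linarith) fun _ _ => by linarith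
    calc |p₁ * p₂ - q₁ * q₂| = |p₁ * (p₂ - q₂) + (p₁ - q₁) * q₂| := by ring_nf
      _ ≤ |p₁| * |p₂ - q₂| + |p₁ - q₁| * |q₂| := by
        rw [← abs_mul, ← abs_mul]
        exact abs_add_le _ _
      _ ≤ 1 * (e / 6) + (e / 6) * 1 := by gcongr
      _ = e / 3 := by ring
  rw [hset]
  have h1 := hN₁ n hn1
  rw [Real.dist_eq] at h1 ⊢
  refine (abs_sub_le _ (∫ ω, F n (observed ε n ω) ∂P) _).trans_lt ?_
  linarith
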